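/- **Model.** Let $\mathcal S$ be a finite set of seller operators and $\mathcal B$ a set of buyer operators. Seller $s$ owns finitely many licensed sub-bands. Each sub-band $l_s$ of $s$ is leased by a finite set of buyers, and $Q_{l_s}$ consists of $s$ and these buyers. Let $\alpha>2$ be the path loss exponent, $P^{\rm S}>0$ the transmit power of every seller base station (BS), $\sigma^2\ge 0$ the noise power and $\zeta_s>0$ the interference threshold of $s$. The BSs of operator $k$ form a homogeneous Poisson process $\Phi_k$ of intensity $\lambda_k>0$ in $\mathbb R^2$, and the users of seller $s$ a homogeneous Poisson process $\Psi_s$ of intensity $\mu_s>0$. All channel gains are exponential with mean $1$. The maximum power that a buyer BS at a point $x\in\mathbb R^2$ may use on $l_s$ is $P^{\rm B}_{l_s}=\zeta_s/H_{l_s}$ with $H_{l_s}=\sup_{y_i\in\Psi_s}h_{i,l_s}\|x-y_i\|^{-\alpha}$, where the $h_{i,l_s}$ are its channel gains to the users of $s$, independent of each other and of $\Psi_s$; the law of $P^{\rm B}_{l_s}$ does not depend on $x$. The transmit powers $P_{f,l_s}$ of the BSs $f$ of the buyers in $Q_{l_s}$ are distributed as $P^{\rm B}_{l_s}$. For each sub-band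 $l_s$, the processes $\Phi_k$ of $s$ and of the buyers, the transmit powers $P_{f,l_s}$ and the channel gains $h_{f,l_s}$ between the BSs and the typical user are mutually independent. A typical user of buyer $b$ is at the origin, and $x_f$ is the distance of BS $f$ from it. On a sub-band $l_s$ with $b\in Q_{l_s}$ it is served by the BS $0$ of $b$ that maximizes the average received power $P_{f,l_s}x_f^{-\alpha}$ (almost surely unique), and with $\mathcal F_k$ the set of BSs of operator $k$ its SINR is $$\gamma_{b,l_s}=\frac{P_{0,l_s}h_{0,l_s}x_0^{-\alpha}}{I_{b,l_s}+\sigma^2},\qquad I_{b,l_s}=\sum_{f\in\mathcal F_b\setminus\{0\}}P_{f,l_s}h_{f,l_s}x_f^{-\alpha}+\sum_{f\in\mathcal F_s}P^{\rm S}h_{f,l_s}x_f^{-\alpha}+\sum_{k\in Q_{l_s}\setminus\{s,b\}}\sum_{f\in\mathcal F_k}P_{f,l_s}h_{f,l_s}x_f^{-\alpha}.$$ The average rate of this user is $$\mathcal R_b=\sum_{l_s:\,b\in Q_{l_s}}\mathbb E_{P}\big[\mathbb E_{\gamma}[\ln(1+\gamma_{b,l_s})]\big],$$ where $\mathbb E_\gamma$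 (and $\mathbb P$ below) refers to the conditional law of $\gamma_{b,l_s}$ given the transmit powers of the buyer BSs on $l_s$, and $\mathbb E_P$ to the law of these powers. **Theorem.** Let $m_{l_s}=\mathbb E[(P^{\rm B}_{l_s})^{2/\alpha}]$, $\lambda_{b,l_s}=\sum_{k\in Q_{l_s}\setminus\{s,b\}}\lambda_k$, $\rho(\alpha,\beta)=\int_{\beta^{-2/\alpha}}^\infty\frac{d\nu}{1+\nu^{\alpha/2}}$, $\rho(\alpha,\infty)=\int_0^\infty\frac{d\nu}{1+\nu^{\alpha/2}}$, and $$\mathcal L_{b,l_s}(\beta,\kappa)=\exp\!\Big(-\pi\kappa^{2/\alpha}\big[\lambda_b m_{l_s}\rho(\alpha,\beta)+\lambda_s(P^{\rm S})^{2/\alpha}\rho(\alpha,\infty)+\lambda_{b,l_s}m_{l_s}\rho(\alpha,\infty)\big]\Big).$$ Then, with all expectations and integrals finite, for every buyer $b$ $$\mathcal R_b=\sum_{l_s:\,b\in Q_{l_s}}\mathbb E_P\Big[\int_0^\infty\mathbb P\big[\ln(1+\gamma_{b,l_s})>t\big]\,dt\Big]$$ $$=\sum_{l_s:\,b\in Q_{l_s}}\int_0^\infty\!\int_0^\infty\pi\lambda_b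 m_{l_s}\,e^{-(e^t-1)\sigma^2z^{\alpha/2}}\,e^{-\pi\lambda_b m_{l_s}z}\,\mathcal L_{b,l_s}\big(e^t-1,\,(e^t-1)z^{\alpha/2}\big)\,dz\,dt.$$ -/

import Mathlib

open MeasureTheory ProbabilityTheory Set
open scoped ENNReal

namespace SpectrumSharing

/-- The Euclidean plane. -/
abbrev Plane : Type := EuclideanSpace ℝ (Fin 2)

/-- The number of points of the sequence `X` that lie in `A`. -/
noncomputable def pointCount {Ω : Type*} (X : ℕ → Ω → Plane) (A : Set Plane) (ω : Ω) : ℝ≥0∞ :=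
  ∑' n, A.indicator 1 (X n ω)

/-- The points `X 0, X 1, …` form a homogeneous Poisson point process of intensity `lam` in the
plane: the number of points in a set of finite area is Poisson with mean `lam` times the area, and
the numbers of points in finitely many disjoint sets are independent. -/
structure IsHomogeneousPPP {Ω : Type*} [MeasurableSpace Ω] (P : Measure Ω)
    (lam : ℝ) (X : ℕ → Ω → Plane) : Prop where
  measurable : ∀ n, Measurable (X n)
  count_law : ∀ A : Set Plane, MeasurableSet A → volume A ≠ ∞ →
    HasLaw (pointCount X A)
      ((poissonMeasure (lam.toNNReal * (volume A).toNNReal)).map (fun k : ℕ => (k : ℝ≥0∞))) P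
  count_indep : ∀ (m : ℕ) (A : Fin m → Set Plane), (∀ i, MeasurableSet (A i)) →
    Pairwise (fun i j => Disjoint (A i) (A j)) → iIndepFun (fun i => pointCount X (A i)) P

/-- The parameters of a network with seller operators `S` and buyer operators `B`. -/
structure Params (S B : Type*) where
  /-- path loss exponent -/
  α : ℝ
  /-- transmit power of the base stations of the sellers -/
  PS : ℝ
  /-- square root of the noise power -/
  σ : ℝ
  /-- number of licensed sub-bands of each seller -/
  numBands : S → ℕ
  /-- the buyers that lease a given sub-band of a given seller -/
  lessees : (Σ s : S, Fin (numBands s)) → Finset B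
  /-- intensity of the base stations of each seller -/
  lamS : S → ℝ
  /-- intensity of the base stations of each buyer -/
  lamB : B → ℝ
  /-- intensity of the users of each seller -/
  muS : S → ℝ
  /-- maximum interference threshold of each seller -/
  ζ : S → ℝ
  α_gt : 2 < α
  PS_pos : 0 < PS
  lamS_pos : ∀ s, 0 < lamS s
  lamB_pos : ∀ b, 0 < lamB b
  muS_pos : ∀ s, 0 < muS s
  ζ_pos : ∀ s, 0 < ζ s

/-- The licensed sub-bands: a seller together with one of its sub-bands. -/
abbrev Params.Band {S B : Type*} (N : Params S B) : Type _ := Σ s : S, Fin (N.numBands s)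

/-- The random variables of the network, seen from a typical buyer user at the origin. -/
structure Network {S B : Type*} (N : Params S B) (Ω : Type*) where
  /-- locations of the base stations of the sellers -/
  siteS : S → ℕ → Ω → Plane
  /-- locations of the base stations of the buyers -/
  siteB : B → ℕ → Ω → Plane
  /-- channel gain between the typical user and a base station of the seller owning the sub-band -/
  gainS : N.Band → ℕ → Ω → ℝ
  /-- channel gain between the typical user and a base station of a buyer on the sub-band -/
  gainB : N.Band → B → ℕ → Ω → ℝ
  /-- transmit power of a base station of a buyer on the sub-band -/
  powB : N.Band → B → ℕ → Ω → ℝ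
  /-- locations of the users of the sellers -/
  userS : S → ℕ → Ω → Plane
  /-- location of an arbitrary buyer base station -/
  refSite : Plane
  /-- channel gain between that base station and the users of the seller owning the sub-band -/
  refGain : N.Band → ℕ → Ω → ℝ

section

variable {S B Ω : Type*} {N : Params S B}

/-- The largest interference channel gain from an arbitrary buyer base station to the users of the
seller that owns the sub-band `l`. -/
noncomputable def Network.refH (R : Network N Ω) (l : N.Band) (ω : Ω) : ℝ :=
  ⨆ i, R.refGain l i ω * ‖R.refSite - R.userS l.1 i ω‖ ^ (-N.α)

/-- The maximum power at which that base station may transmit on the sub-band `l`. -/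
noncomputable def Network.refPow (R : Network N Ω) (l : N.Band) (ω : Ω) : ℝ :=
  N.ζ l.1 / R.refH l ω

/-- The sources of randomness on one sub-band. -/
inductive Source (B : Type*) where
  | sellerSites : Source B
  | buyerSites : B → Source B
  | sellerGain : ℕ → Source B
  | buyerGain : B → ℕ → Source B
  | buyerPower : B → ℕ → Source B

/-- The σ-algebra generated by each source of randomness on the sub-band `l`. -/
@[reducible] def Network.sourceSigma (R : Network N Ω) (l : N.Band) : Source B → MeasurableSpace Ω
  | .sellerSites => MeasurableSpace.comap (fun ω n => R.siteS l.1 n ω) inferInstance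
  | .buyerSites k => MeasurableSpace.comap (fun ω n => R.siteB k n ω) inferInstance
  | .sellerGain n => MeasurableSpace.comap (R.gainS l n) inferInstance
  | .buyerGain k n => MeasurableSpace.comap (R.gainB l k n) inferInstance
  | .buyerPower k n => MeasurableSpace.comap (R.powB l k n) inferInstance

/-- The σ-algebras generated by the users of the seller owning `l` (`none`) and by the channel
gains between them and the reference buyer base station (`some i`). -/
@[reducible] def Network.refSigma (R : Network N Ω) (l : N.Band) : Option ℕ → MeasurableSpace Ω
  | none => MeasurableSpace.comap (fun ω n => R.userS l.1 n ω) inferInstance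
  | some i => MeasurableSpace.comap (R.refGain l i) inferInstance

/-- The probabilistic model: Poisson base stations and users, Rayleigh fading with unit mean,
transmit powers of the buyer base stations distributed as the maximum allowed power of an arbitrary
buyer base station, and on every sub-band independence of all sources of randomness. -/
structure Network.IsModel [MeasurableSpace Ω] (R : Network N Ω) (P : Measure Ω) : Prop where
  siteS_ppp : ∀ s, IsHomogeneousPPP P (N.lamS s) (R.siteS s)
  siteB_ppp : ∀ k, IsHomogeneousPPP P (N.lamB k) (R.siteB k)
  userS_ppp : ∀ s, IsHomogeneousPPP P (N.muS s) (R.userS s)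
  gainS_meas : ∀ l n, Measurable (R.gainS l n)
  gainS_law : ∀ l n, HasLaw (R.gainS l n) (expMeasure 1) P
  gainB_meas : ∀ l k n, Measurable (R.gainB l k n)
  gainB_law : ∀ l, ∀ k ∈ N.lessees l, ∀ n, HasLaw (R.gainB l k n) (expMeasure 1) P
  refGain_meas : ∀ l i, Measurable (R.refGain l i)
  refGain_law : ∀ l i, HasLaw (R.refGain l i) (expMeasure 1) P
  powB_meas : ∀ l k n, Measurable (R.powB l k n)
  powB_law : ∀ l, ∀ k ∈ N.lessees l, ∀ n, IdentDistrib (R.powB l k n) (R.refPow l) P P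
  indep : ∀ l, iIndep (R.sourceSigma l) P
  ref_indep : ∀ l, iIndep (R.refSigma l) P

/-- Average (over the fading) power received at the origin on the sub-band `l` from the `n`-th base
station of buyer `k`. -/
noncomputable def Network.avgRecv (R : Network N Ω) (l : N.Band) (k : B) (n : ℕ) (ω : Ω) : ℝ :=
  R.powB l k n ω * ‖R.siteB k n ω‖ ^ (-N.α)

/-- The base station of buyer `b` that serves the typical user on the sub-band `l`: the one with
maximum average received power (almost surely there is exactly one). -/
noncomputable def Network.serving (R : Network N Ω) (l : N.Band) (b : B) (ω : Ω) : ℕ :=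
  sInf {n | ∀ m, R.avgRecv l b m ω ≤ R.avgRecv l b n ω}

/-- Power received at the origin on the sub-band `l` from the `n`-th base station of buyer `k`. -/
noncomputable def Network.recvB (R : Network N Ω) (l : N.Band) (k : B) (n : ℕ) (ω : Ω) : ℝ :=
  R.powB l k n ω * R.gainB l k n ω * ‖R.siteB k n ω‖ ^ (-N.α)

/-- Power received at the origin on the sub-band `l` from the `n`-th base station of its owner. -/
noncomputable def Network.recvS (R : Network N Ω) (l : N.Band) (n : ℕ) (ω : Ω) : ℝ :=
  N.PS * R.gainS l n ω * ‖R.siteS l.1 n ω‖ ^ (-N.α)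

variable [DecidableEq B]

/-- Interference experienced by the typical user of buyer `b` on the sub-band `l`. -/
noncomputable def Network.interference (R : Network N Ω) (l : N.Band) (b : B) (ω : Ω) : ℝ :=
  (∑' n, if n = R.serving l b ω then 0 else R.recvB l b n ω)
    + (∑' n, R.recvS l n ω)
    + ∑ k ∈ (N.lessees l).erase b, ∑' n, R.recvB l k n ω

/-- Signal-to-interference-plus-noise ratio of the typical user of buyer `b` on the sub-band `l`. -/
noncomputable def Network.sinr (R : Network N Ω) (l : N.Band) (b : B) (ω : Ω) : ℝ :=
  R.recvB l b (R.serving l b ω) ω / (R.interference l b ω + N.σ ^ 2)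

/-- The collection of all transmit powers of buyer base stations on the sub-band `l`. -/
def Network.powers (R : Network N Ω) (l : N.Band) (ω : Ω) : B → ℕ → ℝ :=
  fun k n => R.powB l k n ω

/-- The conditional law of the SINR on the sub-band `l` given the transmit powers there. -/
noncomputable def Network.sinrLaw [MeasurableSpace Ω] (R : Network N Ω) (P : Measure Ω)
    [IsFiniteMeasure P] (l : N.Band) (b : B) : Kernel (B → ℕ → ℝ) ℝ :=
  condDistrib (R.sinr l b) (R.powers l) P

/-- The law of the transmit powers on the sub-band `l`. -/
noncomputable def Network.powerLaw [MeasurableSpace Ω] (R : Network N Ω) (P : Measure Ω)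
    (l : N.Band) : Measure (B → ℕ → ℝ) :=
  P.map (R.powers l)

/-- The average rate of the typical user of buyer `b`: the sum, over the sub-bands leased by `b`, of
the expectation over the powers of the expectation over the SINR of `ln (1 + SINR)`. -/
noncomputable def Network.averageRate [Fintype S] [MeasurableSpace Ω] (R : Network N Ω)
    (P : Measure Ω) [IsFiniteMeasure P] (b : B) : ℝ :=
  ∑ l : N.Band with b ∈ N.lessees l,
    ∫ p, (∫ γ, Real.log (1 + γ) ∂(R.sinrLaw P l b p)) ∂(R.powerLaw P l)

/-- The expectation of the `2 / α`-th power of the transmit power of a buyer base station on `l`. -/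
noncomputable def Network.powMoment [MeasurableSpace Ω] (R : Network N Ω) (P : Measure Ω)
    (l : N.Band) : ℝ :=
  ∫ ω, R.refPow l ω ^ (2 / N.α) ∂P

/-- The function `ρ(α, β)`. -/
noncomputable def rho (α β : ℝ) : ℝ :=
  ∫ ν in Ioi (β ^ (-2 / α)), 1 / (1 + ν ^ (α / 2))

/-- The constant `ρ(α, ∞)`. -/
noncomputable def rhoInf (α : ℝ) : ℝ :=
  ∫ ν in Ioi (0 : ℝ), 1 / (1 + ν ^ (α / 2))

/-- The total intensity of the base stations of the buyers other than `b` that lease `l`. -/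
def otherIntensity (N : Params S B) (l : N.Band) (b : B) : ℝ :=
  ∑ k ∈ (N.lessees l).erase b, N.lamB k

/-- The expression for the Laplace transform of the interference at `κ`, for SINR threshold `β`. -/
noncomputable def Network.laplaceI [MeasurableSpace Ω] (R : Network N Ω) (P : Measure Ω)
    (l : N.Band) (b : B) (β κ : ℝ) : ℝ :=
  Real.exp (-(Real.pi * N.lamB b * R.powMoment P l * κ ^ (2 / N.α) * rho N.α β))
    * Real.exp (-(Real.pi * N.lamS l.1 * N.PS ^ (2 / N.α) * κ ^ (2 / N.α) * rhoInf N.α))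
    * Real.exp (-(Real.pi * otherIntensity N l b * R.powMoment P l * κ ^ (2 / N.α) * rhoInf N.α))

/-- The integrand of the coverage probability at SINR threshold `β`. -/
noncomputable def Network.coverageIntegrand [MeasurableSpace Ω] (R : Network N Ω) (P : Measure Ω)
    (l : N.Band) (b : B) (β z : ℝ) : ℝ :=
  Real.pi * N.lamB b * R.powMoment P l
    * Real.exp (-(β * N.σ ^ 2 * z ^ (N.α / 2)))
    * Real.exp (-(Real.pi * N.lamB b * R.powMoment P l * z))
    * R.laplaceI P l b β (β * z ^ (N.α / 2))

end

end SpectrumSharing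

/-!
All the Poisson processes are handled through their Laplace functionals. The points at which the
average received power of a base station equals `z ^ (-α / 2)` are the images of the plane process
under `(P, x) ↦ (P ‖x‖ ^ (-α)) ^ (-2 / α)`; since `‖x‖ ^ 2` pushes Lebesgue measure to `π` times
Lebesgue measure, marking and mapping turn the base stations of an operator into a Poisson process
on `(0, ∞)` of constant intensity `π λ E[P ^ (2 / α)]`, marked with independent exponential gains.
The powers enter only through that moment. The serving station is the point nearest to `0`, so the
Slivnyak–Mecke formula, disintegrated along the position `z` of that point, reduces the coverage
probability to the probability that an exponential gain exceeds an independent interference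
multiplied by `β z ^ (α / 2)`. This is a Laplace transform, which the Laplace functionals evaluate.
The layer-cake formula converts coverage probabilities into `E[ln (1 + γ)]`, and a bound
`C exp (-2 t / α)` on the coverage at threshold `exp t - 1` makes everything integrable.
-/

namespace SpectrumSharing

open Filter Topology

section NegExp

/-- The function `x ↦ exp (-x)` on `[0, ∞]`, with `exp (-∞) = 0`; Laplace transforms of random
variables that may be infinite are expectations of it. -/
noncomputable def negExp (x : ℝ≥0∞) : ℝ≥0∞ := EReal.exp (-(x : EReal))

/-- The function `x ↦ -log x` on `[0, ∞]`, truncated to `0` above `1`; it inverts `negExp`. -/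
noncomputable def negLog (x : ℝ≥0∞) : ℝ≥0∞ := (-(ENNReal.log x)).toENNReal

@[simp] lemma negExp_zero : negExp 0 = 1 := by simp [negExp]

@[simp] lemma negExp_top : negExp ∞ = 0 := by simp [negExp]

lemma negExp_add (x y : ℝ≥0∞) : negExp (x + y) = negExp x * negExp y := by
  have h : -((x + y : ℝ≥0∞) : EReal) = -(x : EReal) + -(y : EReal) := by
    rw [EReal.coe_ennreal_add, EReal.neg_add (Or.inl (EReal.coe_ennreal_ne_bot x))
      (Or.inr (EReal.coe_ennreal_ne_bot y)), sub_eq_add_neg]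
  rw [negExp, h, EReal.exp_add]; rfl

lemma negExp_ofReal {x : ℝ} (hx : 0 ≤ x) :
    negExp (ENNReal.ofReal x) = ENNReal.ofReal (Real.exp (-x)) := by
  rw [negExp, EReal.coe_ennreal_ofReal, max_eq_left hx, ← EReal.coe_neg, EReal.exp_coe]

lemma antitone_negExp : Antitone negExp := fun _ _ h =>
  EReal.exp_monotone (EReal.neg_le_neg_iff.2 (EReal.coe_ennreal_le_coe_ennreal_iff.2 h))

lemma negExp_injective : Function.Injective negExp := fun x y h => by
  simpa using EReal.exp_strictMono.injective h

lemma negExp_le_one (x : ℝ≥0∞) : negExp x ≤ 1 := by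
  simpa using antitone_negExp (zero_le : 0 ≤ x)

lemma negExp_ne_top (x : ℝ≥0∞) : negExp x ≠ ∞ :=
  ne_top_of_le_ne_top ENNReal.one_ne_top (negExp_le_one x)

@[fun_prop] lemma continuous_negExp : Continuous negExp :=
  ENNReal.continuous_exp.comp (continuous_neg.comp continuous_coe_ennreal_ereal)

@[fun_prop] lemma measurable_negExp : Measurable negExp := continuous_negExp.measurable

@[fun_prop] lemma measurable_negLog : Measurable negLog := by
  have := ENNReal.measurable_log
  unfold negLog
  fun_prop

lemma negExp_negLog {x : ℝ≥0∞} (hx : x ≤ 1) : negExp (negLog x) = x := by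
  rw [negExp, negLog, EReal.coe_toENNReal, neg_neg, ENNReal.exp_log]
  exact EReal.neg_nonneg.2 (ENNReal.log_le_zero_iff.2 hx)

lemma negExp_eq_zero_iff {x : ℝ≥0∞} : negExp x = 0 ↔ x = ∞ := by
  simp [negExp]

lemma negExp_sum {ι : Type*} (s : Finset ι) (f : ι → ℝ≥0∞) :
    negExp (∑ i ∈ s, f i) = ∏ i ∈ s, negExp (f i) := by
  classical
  induction s using Finset.induction_on with
  | empty => simp
  | insert i s hi ih => rw [Finset.sum_insert hi, Finset.prod_insert hi, negExp_add, ih]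

lemma negExp_nat_mul (n : ℕ) (x : ℝ≥0∞) : negExp (n * x) = negExp x ^ n := by
  induction n with
  | zero => simp
  | succ n ih => rw [Nat.cast_succ, add_mul, one_mul, negExp_add, ih, pow_succ]

lemma one_sub_negExp_ofReal {x : ℝ} (hx : 0 ≤ x) :
    1 - negExp (ENNReal.ofReal x) = ENNReal.ofReal (1 - Real.exp (-x)) := by
  rw [negExp_ofReal hx, ENNReal.ofReal_sub _ (Real.exp_nonneg _), ENNReal.ofReal_one]

lemma mul_negExp_le_one_sub_negExp (x : ℝ≥0∞) : x * negExp x ≤ 1 - negExp x := by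
  induction x with
  | top => simp
  | coe x =>
    rw [← ENNReal.ofReal_coe_nnreal, one_sub_negExp_ofReal x.coe_nonneg, negExp_ofReal x.coe_nonneg,
      ← ENNReal.ofReal_mul x.coe_nonneg]
    refine ENNReal.ofReal_le_ofReal (le_sub_iff_add_le.2 ?_)
    calc (x : ℝ) * Real.exp (-x) + Real.exp (-x) = (x + 1) * Real.exp (-x) := by ring
      _ ≤ Real.exp x * Real.exp (-x) := by gcongr; exact Real.add_one_le_exp _
      _ = 1 := by rw [← Real.exp_add, add_neg_cancel, Real.exp_zero]

lemma one_sub_negExp_le (x : ℝ≥0∞) : 1 - negExp x ≤ x := by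
  induction x with
  | top => simp
  | coe x =>
    rw [← ENNReal.ofReal_coe_nnreal, one_sub_negExp_ofReal x.coe_nonneg]
    exact ENNReal.ofReal_le_ofReal (by linarith [Real.one_sub_le_exp_neg (x : ℝ)])

/-- The approximations `2 ^ i * (1 - exp (-x / 2 ^ i))` of `x`, which turn the derivative of a
Laplace transform into a monotone limit. -/
noncomputable def dyadicExp (i : ℕ) (x : ℝ≥0∞) : ℝ≥0∞ := 2 ^ i * (1 - negExp (x / 2 ^ i))

@[fun_prop] lemma measurable_dyadicExp (i : ℕ) : Measurable (dyadicExp i) := by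
  unfold dyadicExp
  fun_prop

lemma monotone_dyadicExp (i : ℕ) : Monotone (dyadicExp i) := fun _ _ h => by
  have := antitone_negExp (ENNReal.div_le_div_right h (2 ^ i))
  unfold dyadicExp
  gcongr

lemma one_sub_negExp_add_self_le (y : ℝ≥0∞) : 1 - negExp (y + y) ≤ 2 * (1 - negExp y) := by
  obtain ⟨c, hc⟩ := exists_add_of_le (negExp_le_one y)
  have hsub : 1 - negExp y = c := by rw [hc, ENNReal.add_sub_cancel_left (negExp_ne_top y)]
  rw [hsub, negExp_add, tsub_le_iff_left]
  calc (1 : ℝ≥0∞) = negExp y * (negExp y + c) + c := by rw [← hc, mul_one, ← hc]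
    _ ≤ negExp y * negExp y + 1 * c + c := by
        rw [mul_add]
        gcongr
        exact negExp_le_one y
    _ = negExp y * negExp y + 2 * c := by ring

lemma monotone_dyadicExp_left (x : ℝ≥0∞) : Monotone fun i => dyadicExp i x := by
  refine monotone_nat_of_le_succ fun i => ?_
  have hx : x / 2 ^ i = x / 2 ^ (i + 1) + x / 2 ^ (i + 1) := by
    rw [pow_succ, ENNReal.div_eq_inv_mul, ENNReal.div_eq_inv_mul,
      ENNReal.mul_inv (Or.inl (by simp)) (Or.inl (by simp)), mul_assoc, ← mul_add, ← add_mul,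
      ENNReal.inv_two_add_inv_two, one_mul]
  calc dyadicExp i x ≤ 2 ^ i * (2 * (1 - negExp (x / 2 ^ (i + 1)))) := by
        rw [dyadicExp, hx]
        gcongr
        exact one_sub_negExp_add_self_le _
    _ = dyadicExp (i + 1) x := by rw [dyadicExp, pow_succ, mul_assoc]

lemma dyadicExp_le (i : ℕ) (x : ℝ≥0∞) : dyadicExp i x ≤ x := by
  calc dyadicExp i x ≤ 2 ^ i * (x / 2 ^ i) := by
        rw [dyadicExp]
        gcongr
        exact one_sub_negExp_le _
    _ = x := ENNReal.mul_div_cancel (by simp) (by simp)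

lemma mul_negExp_le_dyadicExp (i : ℕ) (x : ℝ≥0∞) : x * negExp (x / 2 ^ i) ≤ dyadicExp i x := by
  calc x * negExp (x / 2 ^ i) = 2 ^ i * (x / 2 ^ i * negExp (x / 2 ^ i)) := by
        rw [← mul_assoc, ENNReal.mul_div_cancel (by simp) (by simp)]
    _ ≤ dyadicExp i x := by
        rw [dyadicExp]
        gcongr
        exact mul_negExp_le_one_sub_negExp _

lemma tendsto_div_two_pow {x : ℝ≥0∞} (hx : x ≠ ∞) :
    Tendsto (fun i : ℕ => x / 2 ^ i) atTop (𝓝 0) := by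
  have h := ENNReal.Tendsto.const_mul (a := x)
    (ENNReal.tendsto_pow_atTop_nhds_zero_of_lt_one (r := 2⁻¹) (by simp)) (Or.inr hx)
  simpa only [mul_zero, ← ENNReal.inv_pow, ← div_eq_mul_inv] using h

lemma tendsto_dyadicExp (x : ℝ≥0∞) : Tendsto (fun i => dyadicExp i x) atTop (𝓝 x) := by
  by_cases hx : x = ∞
  · subst hx
    have h : ∀ i : ℕ, dyadicExp i ∞ = 2 ^ i := fun i => by
      simp [dyadicExp, ENNReal.top_div_of_ne_top]
    simp only [h]
    exact ENNReal.tendsto_pow_atTop_nhds_top_iff.2 (by norm_num)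
  · have hlow : Tendsto (fun i : ℕ => x * negExp (x / 2 ^ i)) atTop (𝓝 x) := by
      have h := (continuous_negExp.tendsto 0).comp (tendsto_div_two_pow hx)
      rw [negExp_zero] at h
      simpa using ENNReal.Tendsto.const_mul h (Or.inr hx)
    exact tendsto_of_tendsto_of_tendsto_of_le_of_le hlow tendsto_const_nhds
      (fun i => mul_negExp_le_dyadicExp i x) fun i => dyadicExp_le i x

lemma tendsto_dyadicExp_of_monotone {u : ℕ → ℝ≥0∞} {x : ℝ≥0∞} (hu : Monotone u)
    (hx : Tendsto u atTop (𝓝 x)) : Tendsto (fun i => dyadicExp i (u i)) atTop (𝓝 x) := by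
  refine tendsto_order.2 ⟨fun a ha => ?_, fun a ha => Eventually.of_forall fun i =>
    ((dyadicExp_le i _).trans (hu.ge_of_tendsto hx i)).trans_lt ha⟩
  obtain ⟨j, hj⟩ := ((tendsto_order.1 hx).1 a ha).exists
  obtain ⟨i, hi⟩ := ((tendsto_order.1 (tendsto_dyadicExp (u j))).1 a hj).exists
  filter_upwards [eventually_ge_atTop (max i j)] with k hk
  calc a < dyadicExp i (u j) := hi
    _ ≤ dyadicExp k (u j) := monotone_dyadicExp_left _ ((le_max_left i j).trans hk)
    _ ≤ dyadicExp k (u k) := monotone_dyadicExp k (hu ((le_max_right i j).trans hk))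

end NegExp

section Independence

variable {Ω : Type*} [MeasurableSpace Ω] {P : Measure Ω}

lemma lintegral_negExp_sum_of_iIndepFun {ι : Type*} {W : ι → Ω → ℝ≥0∞}
    (hW : ∀ i, Measurable (W i)) (hind : iIndepFun W P) (s : Finset ι) :
    ∫⁻ ω, negExp (∑ i ∈ s, W i ω) ∂P = ∏ i ∈ s, ∫⁻ ω, negExp (W i ω) ∂P := by
  have hs : iIndepFun (fun (i : s) ω => negExp (W i ω)) P :=
    (hind.precomp Subtype.val_injective).comp (fun _ => negExp) fun _ => measurable_negExp
  have h := lintegral_prod_eq_prod_lintegral_of_indepFun Finset.univ _ hs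
    fun i => measurable_negExp.comp (hW i)
  simp_rw [negExp_sum]
  rw [← Finset.prod_coe_sort s fun i => ∫⁻ ω, negExp (W i ω) ∂P, ← h]
  exact lintegral_congr fun ω => (Finset.prod_coe_sort s fun i => negExp (W i ω)).symm

variable [IsProbabilityMeasure P]

lemma lintegral_negExp_le_one (f : Ω → ℝ≥0∞) : ∫⁻ ω, negExp (f ω) ∂P ≤ 1 :=
  (lintegral_mono fun ω => negExp_le_one (f ω)).trans (by simp)

lemma tendsto_lintegral_negExp {F : ℕ → Ω → ℝ≥0∞} {f : Ω → ℝ≥0∞} (hF : ∀ n, Measurable (F n))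
    (h : ∀ ω, Tendsto (fun n => F n ω) atTop (𝓝 (f ω))) :
    Tendsto (fun n => ∫⁻ ω, negExp (F n ω) ∂P) atTop (𝓝 (∫⁻ ω, negExp (f ω) ∂P)) :=
  tendsto_lintegral_of_dominated_convergence (fun _ => 1)
    (fun n => measurable_negExp.comp (hF n)) (fun n => ae_of_all _ fun ω => negExp_le_one _)
    (by simp) (ae_of_all _ fun ω => (continuous_negExp.tendsto _).comp (h ω))

lemma lintegral_negExp_tsum_of_iIndepFun {W : ℕ → Ω → ℝ≥0∞} (hW : ∀ n, Measurable (W n))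
    (hind : iIndepFun W P) :
    ∫⁻ ω, negExp (∑' n, W n ω) ∂P = negExp (∑' n, negLog (∫⁻ ω, negExp (W n ω) ∂P)) := by
  have hpart : ∀ N, ∫⁻ ω, negExp (∑ n ∈ Finset.range N, W n ω) ∂P
      = negExp (∑ n ∈ Finset.range N, negLog (∫⁻ ω, negExp (W n ω) ∂P)) := fun N => by
    rw [lintegral_negExp_sum_of_iIndepFun hW hind, negExp_sum]
    exact Finset.prod_congr rfl fun n _ => (negExp_negLog (lintegral_negExp_le_one _)).symm
  refine tendsto_nhds_unique (tendsto_lintegral_negExp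
    (F := fun N ω => ∑ n ∈ Finset.range N, W n ω) (fun N => by fun_prop)
    fun ω => ENNReal.tendsto_nat_tsum _) ?_
  simp_rw [hpart]
  exact (continuous_negExp.tendsto _).comp (ENNReal.tendsto_nat_tsum _)

lemma lintegral_of_indepFun {E F : Type*} [MeasurableSpace E] [MeasurableSpace F] {X : Ω → E}
    {Y : Ω → F} (hX : Measurable X) (hY : Measurable Y) (h : IndepFun X Y P) {f : E → F → ℝ≥0∞}
    (hf : Measurable (Function.uncurry f)) :
    ∫⁻ ω, f (X ω) (Y ω) ∂P = ∫⁻ ω, ∫⁻ ω', f (X ω) (Y ω') ∂P ∂P := by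
  have : IsProbabilityMeasure (P.map Y) := Measure.isProbabilityMeasure_map hY.aemeasurable
  calc ∫⁻ ω, f (X ω) (Y ω) ∂P
      = ∫⁻ p, Function.uncurry f p ∂(P.map fun ω => (X ω, Y ω)) := by
        rw [lintegral_map hf (hX.prodMk hY)]; rfl
    _ = ∫⁻ x, ∫⁻ y, f x y ∂(P.map Y) ∂(P.map X) := by
        rw [(indepFun_iff_map_prod_eq_prod_map_map hX.aemeasurable hY.aemeasurable).1 h,
          lintegral_prod _ hf.aemeasurable]
        rfl
    _ = ∫⁻ ω, ∫⁻ y, f (X ω) y ∂(P.map Y) ∂P :=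
        lintegral_map (f := fun x => ∫⁻ y, f x y ∂(P.map Y))
          (Measurable.lintegral_prod_right' hf) hX
    _ = ∫⁻ ω, ∫⁻ ω', f (X ω) (Y ω') ∂P ∂P :=
        lintegral_congr fun ω => lintegral_map (hf.comp measurable_prodMk_left) hY

end Independence

section PPP

variable {Ω E F : Type*} [MeasurableSpace Ω] [MeasurableSpace E] [MeasurableSpace F]

/-- The points `X 0, X 1, …` form a Poisson point process with intensity measure `Λ` on an
arbitrary measurable space. The process is encoded by its Laplace functional, which is what marking,
displacement and Palm calculus act on. -/
structure IsPPP (P : Measure Ω) (Λ : Measure E) (X : ℕ → Ω → E) : Prop where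
  measurable : ∀ n, Measurable (X n)
  laplace : ∀ g : E → ℝ≥0∞, Measurable g →
    ∫⁻ ω, negExp (∑' n, g (X n ω)) ∂P = negExp (∫⁻ x, (1 - negExp (g x)) ∂Λ)

variable {P : Measure Ω} {Λ : Measure E} {X : ℕ → Ω → E}

lemma IsPPP.map (hX : IsPPP P Λ X) {φ : E → F} (hφ : Measurable φ) :
    IsPPP P (Λ.map φ) fun n ω => φ (X n ω) where
  measurable n := hφ.comp (hX.measurable n)
  laplace g hg := by
    rw [hX.laplace (fun x => g (φ x)) (hg.comp hφ),
      lintegral_map (f := fun y => 1 - negExp (g y)) (by fun_prop) hφ]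

variable [IsProbabilityMeasure P]

lemma lintegral_one_sub_negExp_negLog {K : Ω → F} (hK : Measurable K) {g : E × F → ℝ≥0∞}
    (hg : Measurable g) (x : E) :
    1 - negExp (negLog (∫⁻ ω, negExp (g (x, K ω)) ∂P))
      = ∫⁻ k, (1 - negExp (g (x, k))) ∂(P.map K) := by
  have hgx : Measurable fun k => negExp (g (x, k)) := by fun_prop
  have : IsProbabilityMeasure (P.map K) := Measure.isProbabilityMeasure_map hK.aemeasurable
  rw [negExp_negLog (lintegral_negExp_le_one _), ← lintegral_map hgx hK,
    lintegral_sub hgx (ne_top_of_le_ne_top ENNReal.one_ne_top (lintegral_negExp_le_one _))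
      (ae_of_all _ fun k => negExp_le_one _), lintegral_one, measure_univ]

lemma IsPPP.mark (hX : IsPPP P Λ X) {K : ℕ → Ω → F} {ν : Measure F}
    (hK : ∀ n, Measurable (K n)) (hKi : iIndepFun K P) (hν : ∀ n, P.map (K n) = ν)
    (hXK : IndepFun (fun ω n => X n ω) (fun ω n => K n ω) P) :
    IsPPP P (Λ.prod ν) fun n ω => (X n ω, K n ω) where
  measurable n := (hX.measurable n).prodMk (hK n)
  laplace g hg := by
    have hXm := hX.measurable
    have : IsProbabilityMeasure ν := hν 0 ▸ Measure.isProbabilityMeasure_map (hK 0).aemeasurable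
    have hmark : ∀ n x, ∫⁻ ω, negExp (g (x, K n ω)) ∂P = ∫⁻ ω, negExp (g (x, K 0 ω)) ∂P :=
      fun n x => by
        have hgx : Measurable fun k => negExp (g (x, k)) := by fun_prop
        rw [← lintegral_map hgx (hK n), ← lintegral_map hgx (hK 0), hν, hν]
    calc ∫⁻ ω, negExp (∑' n, g (X n ω, K n ω)) ∂P
        = ∫⁻ ω, ∫⁻ ω', negExp (∑' n, g (X n ω, K n ω')) ∂P ∂P :=
          lintegral_of_indepFun (f := fun x k => negExp (∑' n, g (x n, k n)))
            (by fun_prop) (by fun_prop) hXK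
            (measurable_negExp.comp (Measurable.tsum fun n => by fun_prop))
      _ = ∫⁻ ω, negExp (∑' n, negLog (∫⁻ ω', negExp (g (X n ω, K 0 ω')) ∂P)) ∂P := by
          refine lintegral_congr fun ω => ?_
          simp_rw [lintegral_negExp_tsum_of_iIndepFun (W := fun n ω' => g (X n ω, K n ω'))
            (fun n => by fun_prop) (hKi.comp (fun n k => g (X n ω, k)) fun n => by fun_prop), hmark]
      _ = negExp (∫⁻ x, (1 - negExp (negLog (∫⁻ ω, negExp (g (x, K 0 ω)) ∂P))) ∂Λ) :=
          hX.laplace (fun x => negLog (∫⁻ ω, negExp (g (x, K 0 ω)) ∂P)) (by fun_prop)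
      _ = negExp (∫⁻ q, (1 - negExp (g q)) ∂(Λ.prod ν)) := by
          simp_rw [lintegral_one_sub_negExp_negLog (hK 0) hg, hν]
          rw [lintegral_prod _ (by fun_prop)]

end PPP

section HomogeneousPPP

lemma hasSum_poisson_mul_exp (r : NNReal) (y : ℝ) :
    HasSum (fun k : ℕ => Real.exp (-r) * ((r * Real.exp (-y)) ^ k / (k.factorial : ℝ)))
      (Real.exp (-(r * (1 - Real.exp (-y))))) := by
  have h := (NormedSpace.expSeries_div_hasSum_exp (𝔸 := ℝ) (r * Real.exp (-y))).mul_left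
    (Real.exp (-r))
  rwa [← Real.exp_eq_exp_ℝ, ← Real.exp_add,
    show -(r : ℝ) + r * Real.exp (-y) = -(r * (1 - Real.exp (-y))) by ring] at h

lemma lintegral_negExp_poissonMeasure (r : NNReal) {y : ℝ≥0∞} (hy : y ≠ ∞) :
    ∫⁻ k : ℕ, negExp (y * k) ∂(poissonMeasure r) = negExp (r * (1 - negExp y)) := by
  lift y to NNReal using hy
  have hterm : ∀ k : ℕ, negExp (y * k) * poissonMeasure r {k} =
      ENNReal.ofReal (Real.exp (-r) * ((r * Real.exp (-y)) ^ k / (k.factorial : ℝ))) := fun k => by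
    rw [poissonMeasure_singleton, mul_comm (y : ℝ≥0∞), negExp_nat_mul, ← ENNReal.ofReal_coe_nnreal,
      negExp_ofReal y.coe_nonneg, ← ENNReal.ofReal_pow (Real.exp_nonneg _),
      ← ENNReal.ofReal_mul (by positivity)]
    congr 1
    ring
  have hsum := hasSum_poisson_mul_exp r y
  have hexp : 0 ≤ 1 - Real.exp (-y) := sub_nonneg.2 (Real.exp_le_one_iff.2 (by simp))
  rw [lintegral_countable']
  simp_rw [hterm]
  rw [← ENNReal.ofReal_tsum_of_nonneg (fun k => by positivity) hsum.summable, hsum.tsum_eq,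
    ← ENNReal.ofReal_coe_nnreal, ← ENNReal.ofReal_coe_nnreal (p := y),
    one_sub_negExp_ofReal y.coe_nonneg, ← ENNReal.ofReal_mul r.coe_nonneg,
    negExp_ofReal (mul_nonneg r.coe_nonneg hexp)]

variable {Ω : Type*} {X : ℕ → Ω → Plane}

lemma tsum_simpleFunc (g : SimpleFunc Plane ℝ≥0∞) (ω : Ω) :
    ∑' n, g (X n ω) = ∑ y ∈ g.range, y * pointCount X (g ⁻¹' {y}) ω := by
  have h : ∀ n, g (X n ω) = ∑ y ∈ g.range, y * (g ⁻¹' {y}).indicator 1 (X n ω) := fun n => by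
    rw [Finset.sum_eq_single (g (X n ω))]
    · simp
    · intro y _ hy
      rw [indicator_of_notMem (by simpa using hy.symm), mul_zero]
    · exact fun h => absurd (g.mem_range_self _) h
  simp_rw [h, pointCount, ← ENNReal.tsum_mul_left]
  exact Summable.tsum_finsetSum fun _ _ => ENNReal.summable

variable [MeasurableSpace Ω] {P : Measure Ω}

lemma measurable_pointCount (hX : ∀ n, Measurable (X n)) {A : Set Plane}
    (hA : MeasurableSet A) : Measurable (pointCount X A) :=
  Measurable.tsum fun n => (measurable_one.indicator hA).comp (hX n)

variable {lam : ℝ}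

lemma IsHomogeneousPPP.lintegral_negExp_mul_pointCount (hX : IsHomogeneousPPP P lam X)
    {A : Set Plane} (hA : MeasurableSet A) (hvol : volume A ≠ ∞) {y : ℝ≥0∞} (hy : y ≠ ∞) :
    ∫⁻ ω, negExp (y * pointCount X A ω) ∂P
      = negExp (ENNReal.ofReal lam * volume A * (1 - negExp y)) := by
  have hm : Measurable fun t : ℝ≥0∞ => negExp (y * t) := by fun_prop
  rw [(hX.count_law A hA hvol).lintegral_comp (f := fun t => negExp (y * t)) hm.aemeasurable,
    lintegral_map hm (by fun_prop), lintegral_negExp_poissonMeasure _ hy]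
  simp [ENNReal.ofReal, ENNReal.coe_toNNReal hvol]

lemma IsHomogeneousPPP.iIndepFun_pointCount_fiber (hX : IsHomogeneousPPP P lam X)
    (g : SimpleFunc Plane ℝ≥0∞) :
    iIndepFun (fun y : g.range => pointCount X (g ⁻¹' {(y : ℝ≥0∞)})) P := by
  let e := g.range.equivFin
  have h := hX.count_indep _ (fun i => g ⁻¹' {((e.symm i : g.range) : ℝ≥0∞)})
    (fun i => g.measurableSet_fiber _) fun i j hij =>
      Disjoint.preimage _ (disjoint_singleton.2 fun h => hij (e.symm.injective (Subtype.ext h)))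
  simpa using h.precomp e.injective

variable [IsProbabilityMeasure P]

lemma IsHomogeneousPPP.laplace_simpleFunc (hX : IsHomogeneousPPP P lam X)
    (g : SimpleFunc Plane ℝ≥0∞) (hg : ∀ x, g x ≠ ∞)
    (hvol : ∀ y ≠ 0, volume (g ⁻¹' {y}) ≠ ∞) :
    ∫⁻ ω, negExp (∑' n, g (X n ω)) ∂P
      = negExp (∫⁻ x, (1 - negExp (g x)) ∂(ENNReal.ofReal lam • volume)) := by
  have hcount : ∀ y : g.range, Measurable fun ω =>
      (y : ℝ≥0∞) * pointCount X (g ⁻¹' {(y : ℝ≥0∞)}) ω := fun y =>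
    (measurable_pointCount hX.measurable (g.measurableSet_fiber _)).const_mul _
  have hfiber : ∀ y : g.range, ∫⁻ ω, negExp (y * pointCount X (g ⁻¹' {(y : ℝ≥0∞)}) ω) ∂P
      = negExp ((1 - negExp y) * (ENNReal.ofReal lam • volume) (g ⁻¹' {(y : ℝ≥0∞)})) := by
    rintro ⟨y, hy⟩
    obtain ⟨x, rfl⟩ := SimpleFunc.mem_range.1 hy
    by_cases h0 : g x = 0
    · simp [h0]
    · rw [hX.lintegral_negExp_mul_pointCount (g.measurableSet_fiber _) (hvol _ h0) (hg x),
        mul_comm, Measure.smul_apply, smul_eq_mul]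
  have hint : ∫⁻ x, (1 - negExp (g x)) ∂(ENNReal.ofReal lam • volume)
      = ∑ y : g.range, (1 - negExp y) * (ENNReal.ofReal lam • volume) (g ⁻¹' {(y : ℝ≥0∞)}) := by
    rw [Finset.sum_coe_sort g.range fun y =>
      (1 - negExp y) * (ENNReal.ofReal lam • volume) (g ⁻¹' {y}), ← SimpleFunc.map_lintegral,
      ← SimpleFunc.lintegral_eq_lintegral]
    rfl
  simp_rw [tsum_simpleFunc, hint, negExp_sum, ← hfiber]
  rw [← lintegral_negExp_sum_of_iIndepFun hcount
    ((hX.iIndepFun_pointCount_fiber g).comp (fun y t => (y : ℝ≥0∞) * t) fun y => by fun_prop)]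
  simp_rw [negExp_sum]
  exact lintegral_congr fun ω => (Finset.prod_coe_sort g.range fun y =>
    negExp (y * pointCount X (g ⁻¹' {y}) ω)).symm

lemma tsum_iSup_of_monotone {G : ℕ → ℕ → ℝ≥0∞} (hG : Monotone G) :
    ∑' n, ⨆ j, G j n = ⨆ j, ∑' n, G j n := by
  simp_rw [← lintegral_count]
  exact lintegral_iSup (fun j => measurable_from_top) hG

lemma laplace_iSup_of_monotone {E : Type*} [MeasurableSpace E] {Λ : Measure E} {X : ℕ → Ω → E}
    (hX : ∀ n, Measurable (X n)) {G : ℕ → E → ℝ≥0∞} (hG : ∀ j, Measurable (G j))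
    (hmono : Monotone G)
    (h : ∀ j, ∫⁻ ω, negExp (∑' n, G j (X n ω)) ∂P = negExp (∫⁻ x, (1 - negExp (G j x)) ∂Λ)) :
    ∫⁻ ω, negExp (∑' n, ⨆ j, G j (X n ω)) ∂P
      = negExp (∫⁻ x, (1 - negExp (⨆ j, G j x)) ∂Λ) := by
  have hleft : Tendsto (fun j => ∫⁻ ω, negExp (∑' n, G j (X n ω)) ∂P) atTop
      (𝓝 (∫⁻ ω, negExp (∑' n, ⨆ j, G j (X n ω)) ∂P)) := by
    refine tendsto_lintegral_negExp (fun j => Measurable.tsum fun n => (hG j).comp (hX n))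
      fun ω => ?_
    rw [tsum_iSup_of_monotone (G := fun j n => G j (X n ω)) fun i j hij n => hmono hij _]
    exact tendsto_atTop_iSup fun i j hij => ENNReal.tsum_le_tsum fun n => hmono hij _
  have hright : Tendsto (fun j => ∫⁻ x, (1 - negExp (G j x)) ∂Λ) atTop
      (𝓝 (∫⁻ x, (1 - negExp (⨆ j, G j x)) ∂Λ)) := by
    refine lintegral_tendsto_of_tendsto_of_monotone (fun j => by fun_prop)
      (ae_of_all _ fun x i j hij => tsub_le_tsub_left (antitone_negExp (hmono hij x)) _)
      (ae_of_all _ fun x => ENNReal.Tendsto.sub tendsto_const_nhds ?_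
        (Or.inl ENNReal.one_ne_top))
    exact (continuous_negExp.tendsto _).comp (tendsto_atTop_iSup fun i j hij => hmono hij x)
  refine tendsto_nhds_unique hleft ?_
  simp_rw [h]
  exact (continuous_negExp.tendsto _).comp hright

/-- The `j`-th simple approximation of `g`, cut off outside the disc of radius `j` so that its
level sets have finite area. -/
noncomputable def discApprox (g : Plane → ℝ≥0∞) (j : ℕ) : SimpleFunc Plane ℝ≥0∞ :=
  (SimpleFunc.eapprox g j).restrict (Metric.ball 0 j)

lemma discApprox_apply (g : Plane → ℝ≥0∞) (j : ℕ) (x : Plane) :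
    discApprox g j x = (Metric.ball (0 : Plane) j).indicator (SimpleFunc.eapprox g j) x :=
  SimpleFunc.restrict_apply _ measurableSet_ball _

lemma discApprox_ne_top (g : Plane → ℝ≥0∞) (j : ℕ) (x : Plane) : discApprox g j x ≠ ∞ := by
  rw [discApprox_apply]
  exact ne_top_of_le_ne_top (SimpleFunc.eapprox_lt_top g j x).ne (indicator_le_self _ _ x)

lemma volume_discApprox_fiber_ne_top (g : Plane → ℝ≥0∞) (j : ℕ) {y : ℝ≥0∞} (hy : y ≠ 0) :
    volume (discApprox g j ⁻¹' {y}) ≠ ∞ := by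
  refine ne_top_of_le_ne_top (measure_ball_lt_top (x := (0 : Plane)) (r := j)).ne
    (measure_mono fun x hx => by_contra fun hxj => hy ?_)
  rw [← mem_singleton_iff.1 hx, discApprox_apply, indicator_of_notMem hxj]

lemma monotone_discApprox (g : Plane → ℝ≥0∞) : Monotone fun j x => discApprox g j x := by
  intro i j hij x
  simp only [discApprox_apply]
  calc (Metric.ball (0 : Plane) i).indicator (SimpleFunc.eapprox g i) x
      ≤ (Metric.ball (0 : Plane) i).indicator (SimpleFunc.eapprox g j) x :=
        indicator_le_indicator (SimpleFunc.monotone_eapprox g hij x)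
    _ ≤ (Metric.ball (0 : Plane) j).indicator (SimpleFunc.eapprox g j) x :=
        indicator_le_indicator_of_subset (Metric.ball_subset_ball (by exact_mod_cast hij))
          (fun _ => zero_le) x

lemma iSup_discApprox {g : Plane → ℝ≥0∞} (hg : Measurable g) (x : Plane) :
    ⨆ j, discApprox g j x = g x := by
  have happrox : Tendsto (fun j => SimpleFunc.eapprox g j x) atTop (𝓝 (g x)) := by
    rw [← SimpleFunc.iSup_eapprox_apply hg x]
    exact tendsto_atTop_iSup fun i j hij => SimpleFunc.monotone_eapprox g hij x
  obtain ⟨N, hN⟩ := exists_nat_gt ‖x‖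
  refine tendsto_nhds_unique (tendsto_atTop_iSup fun i j hij => monotone_discApprox g hij x)
    (happrox.congr' ?_)
  filter_upwards [eventually_ge_atTop N] with j hj
  have hxj : x ∈ Metric.ball (0 : Plane) j := by
    rw [mem_ball_zero_iff]
    exact hN.trans_le (by exact_mod_cast hj)
  rw [discApprox_apply, indicator_of_mem hxj]

lemma IsHomogeneousPPP.isPPP (hX : IsHomogeneousPPP P lam X) :
    IsPPP P (ENNReal.ofReal lam • volume) X where
  measurable := hX.measurable
  laplace g hg := by
    have h := laplace_iSup_of_monotone hX.measurable (fun j => (discApprox g j).measurable)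
      (monotone_discApprox g) fun j => hX.laplace_simpleFunc _ (discApprox_ne_top g j)
        fun y hy => volume_discApprox_fiber_ne_top g j hy
    simpa only [iSup_discApprox hg] using h

end HomogeneousPPP

section Campbell

/-- The sum of `f` over all indices but `n`. -/
noncomputable def sumExcept (n : ℕ) (f : ℕ → ℝ≥0∞) : ℝ≥0∞ := ∑' m, if m = n then 0 else f m

lemma add_sumExcept (n : ℕ) (f : ℕ → ℝ≥0∞) : f n + sumExcept n f = ∑' m, f m := by
  rw [sumExcept, ENNReal.tsum_eq_add_tsum_ite (f := f) n]
  congr!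

variable {Ω E : Type*} [MeasurableSpace Ω] [MeasurableSpace E]

@[fun_prop] lemma measurable_sumExcept {f : ℕ → E → ℝ≥0∞} (n : ℕ)
    (hf : ∀ m, Measurable (f m)) : Measurable fun x => sumExcept n fun m => f m x := by
  refine Measurable.tsum fun m => ?_
  split_ifs
  · exact measurable_const
  · exact hf m

variable {P : Measure Ω} [IsProbabilityMeasure P] {Λ : Measure E} {X : ℕ → Ω → E}

lemma one_sub_negExp_add (x y : ℝ≥0∞) :
    1 - negExp (x + y) = (1 - negExp x) + (1 - negExp y) * negExp x := by
  rw [ENNReal.sub_mul fun _ _ => negExp_ne_top x, one_mul, mul_comm, ← negExp_add]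
  refine (tsub_add_tsub_cancel (negExp_le_one x) (antitone_negExp le_self_add)).symm

lemma IsPPP.lintegral_one_sub_negExp_mul (hX : IsPPP P Λ X)
    {f h : E → ℝ≥0∞} (hf : Measurable f) (hh : Measurable h) :
    ∫⁻ ω, (1 - negExp (∑' n, f (X n ω))) * negExp (∑' n, h (X n ω)) ∂P
      = (1 - negExp (∫⁻ x, (1 - negExp (f x)) * negExp (h x) ∂Λ))
        * negExp (∫⁻ x, (1 - negExp (h x)) ∂Λ) := by
  have hXm := hX.measurable
  have hsum : ∫⁻ x, (1 - negExp (h x + f x)) ∂Λ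
      = ∫⁻ x, (1 - negExp (h x)) ∂Λ + ∫⁻ x, (1 - negExp (f x)) * negExp (h x) ∂Λ := by
    simp_rw [one_sub_negExp_add]
    exact lintegral_add_left (by fun_prop) _
  calc ∫⁻ ω, (1 - negExp (∑' n, f (X n ω))) * negExp (∑' n, h (X n ω)) ∂P
      = ∫⁻ ω, (negExp (∑' n, h (X n ω)) - negExp (∑' n, (h (X n ω) + f (X n ω)))) ∂P := by
        refine lintegral_congr fun ω => ?_
        rw [ENNReal.tsum_add, negExp_add, ENNReal.sub_mul fun _ _ => negExp_ne_top _, one_mul,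
          mul_comm (negExp _)]
    _ = ∫⁻ ω, negExp (∑' n, h (X n ω)) ∂P
          - ∫⁻ ω, negExp (∑' n, (h (X n ω) + f (X n ω))) ∂P := by
        refine lintegral_sub (by fun_prop)
          (ne_top_of_le_ne_top ENNReal.one_ne_top (lintegral_negExp_le_one _))
          (ae_of_all _ fun ω => antitone_negExp (ENNReal.tsum_le_tsum fun n => le_self_add))
    _ = _ := by
        rw [hX.laplace h hh, hX.laplace (fun x => h x + f x) (hh.add hf), hsum, negExp_add,
          ENNReal.sub_mul fun _ _ => negExp_ne_top _, one_mul, mul_comm (negExp _) (negExp _)]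

lemma IsPPP.lintegral_dyadicExp_mul (hX : IsPPP P Λ X)
    {f h : E → ℝ≥0∞} (hf : Measurable f) (hh : Measurable h) (i : ℕ) :
    ∫⁻ ω, dyadicExp i (∑' n, f (X n ω)) * negExp (∑' n, h (X n ω)) ∂P
      = dyadicExp i (∫⁻ x, dyadicExp i (f x) * negExp (h x) ∂Λ)
        * negExp (∫⁻ x, (1 - negExp (h x)) ∂Λ) := by
  have hXm := hX.measurable
  have hscale : ∫⁻ x, dyadicExp i (f x) * negExp (h x) ∂Λ
      = 2 ^ i * ∫⁻ x, (1 - negExp (f x / 2 ^ i)) * negExp (h x) ∂Λ := by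
    simp_rw [dyadicExp, mul_assoc]
    exact lintegral_const_mul _ (by fun_prop)
  have hcancel : ∀ x : ℝ≥0∞, 2 ^ i * x / 2 ^ i = x := fun x => by
    rw [mul_comm, ENNReal.mul_div_cancel_right (by simp) (by simp)]
  simp_rw [hscale, dyadicExp, hcancel, mul_assoc]
  rw [lintegral_const_mul _ (by fun_prop),
    ← hX.lintegral_one_sub_negExp_mul (f := fun x => f x / 2 ^ i) (by fun_prop) hh]
  simp_rw [div_eq_mul_inv, ENNReal.tsum_mul_right]

lemma tendsto_lintegral_dyadicExp_mul {μ : Measure E} {f h : E → ℝ≥0∞} (hf : Measurable f)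
    (hh : Measurable h) :
    Tendsto (fun i => ∫⁻ x, dyadicExp i (f x) * negExp (h x) ∂μ) atTop
      (𝓝 (∫⁻ x, f x * negExp (h x) ∂μ)) :=
  lintegral_tendsto_of_tendsto_of_monotone (fun i => by fun_prop)
    (ae_of_all _ fun x i j hij => mul_le_mul_left (monotone_dyadicExp_left _ hij) _)
    (ae_of_all _ fun x => ENNReal.Tendsto.mul_const (tendsto_dyadicExp _)
      (Or.inr (negExp_ne_top _)))

lemma IsPPP.lintegral_tsum_mul_negExp (hX : IsPPP P Λ X)
    {f h : E → ℝ≥0∞} (hf : Measurable f) (hh : Measurable h) :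
    ∫⁻ ω, (∑' n, f (X n ω)) * negExp (∑' n, h (X n ω)) ∂P
      = (∫⁻ x, f x * negExp (h x) ∂Λ) * negExp (∫⁻ x, (1 - negExp (h x)) ∂Λ) := by
  have hXm := hX.measurable
  have hmono : Monotone fun i => ∫⁻ x, dyadicExp i (f x) * negExp (h x) ∂Λ := fun i j hij =>
    lintegral_mono fun x => mul_le_mul_left (monotone_dyadicExp_left _ hij) _
  refine tendsto_nhds_unique (tendsto_lintegral_dyadicExp_mul
    (f := fun ω => ∑' n, f (X n ω)) (h := fun ω => ∑' n, h (X n ω)) (by fun_prop)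
    (by fun_prop)) ?_
  simp_rw [hX.lintegral_dyadicExp_mul hf hh]
  exact ENNReal.Tendsto.mul_const
    (tendsto_dyadicExp_of_monotone hmono (tendsto_lintegral_dyadicExp_mul hf hh))
    (Or.inr (negExp_ne_top _))

lemma IsPPP.lintegral_tsum_mul_negExp_sumExcept (hX : IsPPP P Λ X)
    {f h : E → ℝ≥0∞} (hf : Measurable f) (hh : Measurable h) (hfin : ∀ x, h x ≠ ∞) :
    ∫⁻ ω, ∑' n, f (X n ω) * negExp (sumExcept n fun m => h (X m ω)) ∂P
      = (∫⁻ x, f x ∂Λ) * negExp (∫⁻ x, (1 - negExp (h x)) ∂Λ) := by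
  have hne : ∀ x, negExp (h x) ≠ 0 := fun x => negExp_eq_zero_iff.not.2 (hfin x)
  have key := hX.lintegral_tsum_mul_negExp (f := fun x => f x * (negExp (h x))⁻¹)
    (by fun_prop) hh
  simp_rw [mul_assoc, ENNReal.inv_mul_cancel (hne _) (negExp_ne_top _), mul_one] at key
  rw [← key]
  refine lintegral_congr fun ω => ?_
  rw [← ENNReal.tsum_mul_right]
  refine tsum_congr fun n => ?_
  rw [← add_sumExcept n, negExp_add, mul_assoc, ← mul_assoc (negExp _)⁻¹,
    ENNReal.inv_mul_cancel (hne _) (negExp_ne_top _), one_mul]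

end Campbell

section LaplaceUniqueness

open BoundedContinuousFunction

variable {ι : Type*}

lemma continuous_toReal_negExp_sum (a : ι →₀ NNReal) :
    Continuous fun x : ι → ℝ≥0∞ => (negExp (a.sum fun i c => c * x i)).toReal :=
  ENNReal.continuousOn_toReal.comp_continuous
    (continuous_negExp.comp (continuous_finsetSum _ fun i _ =>
      (ENNReal.continuous_const_mul ENNReal.coe_ne_top).comp (continuous_apply i)))
    fun _ => negExp_ne_top _

/-- The bounded continuous functions `x ↦ exp (-∑ i, a i * x i)` on `ι → [0, ∞]`, indexed
multiplicatively by the finitely supported `a`; their span is an algebra. -/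
noncomputable def expFunctional :
    Multiplicative (ι →₀ NNReal) →* BoundedContinuousFunction (ι → ℝ≥0∞) ℝ where
  toFun a := BoundedContinuousFunction.ofNormedAddCommGroup
    (fun x => (negExp (a.toAdd.sum fun i c => c * x i)).toReal)
    (continuous_toReal_negExp_sum a.toAdd) 1 fun x => by
      rw [Real.norm_of_nonneg ENNReal.toReal_nonneg]
      exact ENNReal.toReal_le_of_le_ofReal zero_le_one (by simpa using negExp_le_one _)
  map_one' := by ext; simp
  map_mul' a b := by
    ext x
    simp [Finsupp.sum_add_index', add_mul, negExp_add]

lemma expFunctional_apply (a : Multiplicative (ι →₀ NNReal)) (x : ι → ℝ≥0∞) :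
    expFunctional a x = (negExp (a.toAdd.sum fun i c => c * x i)).toReal := rfl

/-- The real algebra spanned by the functions `expFunctional a`. -/
noncomputable def expAlgebra (ι : Type*) :
    StarSubalgebra ℝ (BoundedContinuousFunction (ι → ℝ≥0∞) ℝ) where
  toSubalgebra := Algebra.adjoin ℝ (MonoidHom.mrange (expFunctional (ι := ι)))
  star_mem' {f} hf := by
    have hstar : star f = f := by ext; simp
    simpa only [hstar] using hf

lemma mem_expAlgebra {f : BoundedContinuousFunction (ι → ℝ≥0∞) ℝ} :
    f ∈ expAlgebra ι ↔ f ∈ Submodule.span ℝ (range (expFunctional (ι := ι))) := by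
  have h : f ∈ expAlgebra ι ↔ f ∈ Subalgebra.toSubmodule
    (Algebra.adjoin ℝ (MonoidHom.mrange (expFunctional (ι := ι)) : Set _)) := Iff.rfl
  rw [h, Algebra.adjoin_eq_span, Submonoid.closure_eq, MonoidHom.coe_mrange]

lemma separatesPoints_expAlgebra :
    ((expAlgebra ι).map (toContinuousMapStarₐ ℝ)).SeparatesPoints := by
  intro x y hxy
  obtain ⟨i, hi⟩ := Function.ne_iff.1 hxy
  let a : Multiplicative (ι →₀ NNReal) := .ofAdd (Finsupp.single i 1)
  have happly : ∀ z, expFunctional a z = (negExp (z i)).toReal := fun z => by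
    simp [a, expFunctional_apply]
  refine ⟨_, ⟨_, ⟨expFunctional a, mem_expAlgebra.2 (Submodule.subset_span ⟨a, rfl⟩), rfl⟩, rfl⟩,
    fun h => hi (negExp_injective ?_)⟩
  have h' : expFunctional a x = expFunctional a y := h
  rwa [happly, happly, ENNReal.toReal_eq_toReal_iff' (negExp_ne_top _) (negExp_ne_top _)] at h'

lemma measure_ext_of_laplace [Countable ι] {μ ν : Measure (ι → ℝ≥0∞)} [IsFiniteMeasure μ]
    [IsFiniteMeasure ν]
    (h : ∀ a : ι →₀ NNReal, ∫⁻ x, negExp (a.sum fun i c => c * x i) ∂μ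
      = ∫⁻ x, negExp (a.sum fun i c => c * x i) ∂ν) : μ = ν := by
  refine ext_of_forall_mem_subalgebra_integral_eq_of_polish separatesPoints_expAlgebra
    fun f hf => ?_
  replace hf := mem_expAlgebra.1 hf
  induction hf using Submodule.span_induction with
  | mem f hf =>
    obtain ⟨a, rfl⟩ := hf
    have hm : Measurable fun x : ι → ℝ≥0∞ => negExp (a.toAdd.sum fun i c => c * x i) :=
      measurable_negExp.comp (Finset.measurable_sum _ fun i _ => by fun_prop)
    simp_rw [expFunctional_apply]
    rw [integral_toReal hm.aemeasurable (ae_of_all _ fun x => (negExp_ne_top _).lt_top),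
      integral_toReal hm.aemeasurable (ae_of_all _ fun x => (negExp_ne_top _).lt_top), h]
  | zero => simp
  | add f g _ _ ihf ihg =>
    simp only [BoundedContinuousFunction.coe_add, Pi.add_apply]
    rw [integral_add (f.integrable _) (g.integrable _), integral_add (f.integrable _)
      (g.integrable _), ihf, ihg]
  | smul c f _ ih =>
    simp only [BoundedContinuousFunction.coe_smul, integral_const_mul, smul_eq_mul, ih]

end LaplaceUniqueness

section SlivnyakMecke

variable {Ω E ι : Type*} [MeasurableSpace Ω] [MeasurableSpace E] {P : Measure Ω} {Λ : Measure E}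
  {X : ℕ → Ω → E} {p : ι → E → ℝ≥0∞}

lemma sum_mul_sumExcept (a : ι →₀ NNReal) (n : ℕ) (x : ι → ℕ → ℝ≥0∞) :
    (a.sum fun i c => c * sumExcept n (x i)) = sumExcept n fun m => a.sum fun i c => c * x i m := by
  simp_rw [sumExcept, Finsupp.sum, ← ENNReal.tsum_mul_left]
  rw [← Summable.tsum_finsetSum fun _ _ => ENNReal.summable]
  refine tsum_congr fun m => ?_
  split_ifs <;> simp

lemma sum_mul_tsum (a : ι →₀ NNReal) (x : ι → ℕ → ℝ≥0∞) :
    (a.sum fun i c => c * ∑' n, x i n) = ∑' n, a.sum fun i c => c * x i n := by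
  simp_rw [Finsupp.sum, ← ENNReal.tsum_mul_left]
  exact (Summable.tsum_finsetSum fun _ _ => ENNReal.summable).symm

/-- The reduced Campbell measure of the process `X`, seen through the functionals
`∑ n, p i (X n)`: the sum over `n` of the joint laws of the point `X n` and the functionals of the
other points. -/
noncomputable def campbellMeasure (P : Measure Ω) (X : ℕ → Ω → E) (p : ι → E → ℝ≥0∞) :
    Measure (E × (ι → ℝ≥0∞)) :=
  Measure.sum fun n => P.map fun ω => (X n ω, fun i => sumExcept n fun m => p i (X m ω))

lemma lintegral_campbellMeasure (hX : ∀ n, Measurable (X n)) (hp : ∀ i, Measurable (p i))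
    {F : E × (ι → ℝ≥0∞) → ℝ≥0∞} (hF : Measurable F) :
    ∫⁻ q, F q ∂(campbellMeasure P X p)
      = ∫⁻ ω, ∑' n, F (X n ω, fun i => sumExcept n fun m => p i (X m ω)) ∂P := by
  rw [campbellMeasure, lintegral_sum_measure, lintegral_tsum fun n => by fun_prop]
  exact tsum_congr fun n => lintegral_map hF (by fun_prop)

variable [IsProbabilityMeasure P]

lemma IsPPP.lintegral_mul_negExp_campbellMeasure (hX : IsPPP P Λ X)
    (hp : ∀ i, Measurable (p i)) (hfin : ∀ i x, p i x ≠ ∞) {f : E → ℝ≥0∞} (hf : Measurable f)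
    (a : ι →₀ NNReal) :
    ∫⁻ q, f q.1 * negExp (a.sum fun i c => c * q.2 i) ∂(campbellMeasure P X p)
      = (∫⁻ x, f x ∂Λ) * ∫⁻ ω, negExp (a.sum fun i c => c * ∑' n, p i (X n ω)) ∂P := by
  have hh : Measurable fun x => a.sum fun i c => c * p i x :=
    Finset.measurable_sum _ fun i _ => by fun_prop
  have hne : ∀ x, (a.sum fun i c => c * p i x) ≠ ∞ := fun x =>
    ENNReal.sum_ne_top.2 fun i _ => ENNReal.mul_ne_top ENNReal.coe_ne_top (hfin i x)
  have hF : Measurable fun q : E × (ι → ℝ≥0∞) =>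
      f q.1 * negExp (a.sum fun i c => c * q.2 i) :=
    (hf.comp measurable_fst).mul
      (measurable_negExp.comp (Finset.measurable_sum _ fun i _ => by fun_prop))
  rw [lintegral_campbellMeasure hX.measurable hp hF]
  simp_rw [sum_mul_sumExcept, sum_mul_tsum]
  rw [hX.lintegral_tsum_mul_negExp_sumExcept hf hh hne, hX.laplace _ hh]

variable [Countable ι]

lemma IsPPP.campbellMeasure_prod_of_ne_top (hX : IsPPP P Λ X)
    (hp : ∀ i, Measurable (p i)) (hfin : ∀ i x, p i x ≠ ∞) {A : Set E} (hA : MeasurableSet A)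
    (hΛA : Λ A ≠ ∞) {S : Set (ι → ℝ≥0∞)} (hS : MeasurableSet S) :
    campbellMeasure P X p (A ×ˢ S) = Λ A * P.map (fun ω i => ∑' n, p i (X n ω)) S := by
  have hXm := hX.measurable
  let μ := ((campbellMeasure P X p).restrict (A ×ˢ univ)).map Prod.snd
  let ν := Λ A • P.map fun ω i => ∑' n, p i (X n ω)
  have hlaplace : ∀ a : ι →₀ NNReal, ∫⁻ x, negExp (a.sum fun i c => c * x i) ∂μ
      = ∫⁻ x, negExp (a.sum fun i c => c * x i) ∂ν := fun a => by
    have hm : Measurable fun x : ι → ℝ≥0∞ => negExp (a.sum fun i c => c * x i) :=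
      measurable_negExp.comp (Finset.measurable_sum _ fun i _ => by fun_prop)
    have hind : ∀ q : E × (ι → ℝ≥0∞), (A ×ˢ univ).indicator
        (fun q : E × (ι → ℝ≥0∞) => negExp (a.sum fun i c => c * q.2 i)) q
          = A.indicator 1 q.1 * negExp (a.sum fun i c => c * q.2 i) := fun q => by
      by_cases hq : q.1 ∈ A <;> simp [hq]
    rw [lintegral_map hm measurable_snd, ← lintegral_indicator (hA.prod .univ),
      lintegral_congr hind, hX.lintegral_mul_negExp_campbellMeasure hp hfin
        (measurable_one.indicator hA), lintegral_indicator_one hA, lintegral_smul_measure,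
      lintegral_map hm (by fun_prop), smul_eq_mul]
  have hνfin : IsFiniteMeasure ν := ⟨by
    rw [Measure.smul_apply, Measure.map_apply (by fun_prop) .univ]
    simpa using hΛA.lt_top⟩
  have hμfin : IsFiniteMeasure μ := ⟨by
    have h0 := hlaplace 0
    simp only [Finsupp.sum_zero_index, negExp_zero, lintegral_one] at h0
    exact h0 ▸ measure_lt_top ν univ⟩
  have hμS : μ S = campbellMeasure P X p (A ×ˢ S) := by
    rw [Measure.map_apply measurable_snd hS, Measure.restrict_apply (measurable_snd hS),
      ← univ_prod, prod_inter_prod, univ_inter, inter_univ]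
  rw [← hμS, measure_ext_of_laplace hlaplace, Measure.smul_apply, smul_eq_mul]

lemma IsPPP.campbellMeasure_eq_prod [SigmaFinite Λ] (hX : IsPPP P Λ X)
    (hp : ∀ i, Measurable (p i)) (hfin : ∀ i x, p i x ≠ ∞) :
    campbellMeasure P X p = Λ.prod (P.map fun ω i => ∑' n, p i (X n ω)) := by
  have hXm := hX.measurable
  have : IsProbabilityMeasure (P.map fun ω i => ∑' n, p i (X n ω)) :=
    Measure.isProbabilityMeasure_map (by fun_prop)
  refine (Measure.prod_eq fun A S hA hS => ?_).symm
  have hmono : Monotone fun j => A ∩ spanningSets Λ j := fun i j hij =>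
    inter_subset_inter_right _ (monotone_spanningSets Λ hij)
  have hA' : A = ⋃ j, A ∩ spanningSets Λ j := by
    rw [← inter_iUnion, iUnion_spanningSets, inter_univ]
  have hleft := tendsto_measure_iUnion_atTop (μ := campbellMeasure P X p)
    (hmono.set_prod (monotone_const (c := S)))
  have hright := ENNReal.Tendsto.mul_const (tendsto_measure_iUnion_atTop (μ := Λ) hmono)
    (Or.inr (measure_ne_top (P.map fun ω i => ∑' n, p i (X n ω)) S))
  rw [← iUnion_prod_const, ← hA'] at hleft
  rw [← hA'] at hright
  refine tendsto_nhds_unique hleft (hright.congr fun j => ?_)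
  exact (hX.campbellMeasure_prod_of_ne_top hp hfin (hA.inter (measurableSet_spanningSets Λ j))
    (ne_top_of_le_ne_top (measure_spanningSets_lt_top Λ j).ne (measure_mono inter_subset_right))
    hS).symm

lemma IsPPP.lintegral_tsum_sumExcept [SigmaFinite Λ] (hX : IsPPP P Λ X)
    (hp : ∀ i, Measurable (p i)) (hfin : ∀ i x, p i x ≠ ∞) {F : E × (ι → ℝ≥0∞) → ℝ≥0∞}
    (hF : Measurable F) :
    ∫⁻ ω, ∑' n, F (X n ω, fun i => sumExcept n fun m => p i (X m ω)) ∂P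
      = ∫⁻ x, ∫⁻ ω, F (x, fun i => ∑' n, p i (X n ω)) ∂P ∂Λ := by
  have hXm := hX.measurable
  have hZ : Measurable fun ω i => ∑' n, p i (X n ω) := by fun_prop
  have : IsProbabilityMeasure (P.map fun ω i => ∑' n, p i (X n ω)) :=
    Measure.isProbabilityMeasure_map hZ.aemeasurable
  rw [← lintegral_campbellMeasure hXm hp hF, hX.campbellMeasure_eq_prod hp hfin,
    lintegral_prod _ hF.aemeasurable]
  exact lintegral_congr fun x => lintegral_map (hF.comp measurable_prodMk_left) hZ

end SlivnyakMecke

section NearestPoint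

variable {E : Type*}

/-- The weights whose sums over the points of a process decide whether all points are at distance
`τ` at least `q`, for every rational `q`; the index `none` carries the interference `w`. -/
noncomputable def nearestWeight (τ : E → ℝ) (w : E → ℝ≥0∞) (o : Option ℚ) (x : E) : ℝ≥0∞ :=
  o.elim (w x) fun q => (Iio (q : ℝ)).indicator 1 (τ x)

lemma nearestWeight_ne_top (τ : E → ℝ) {w : E → ℝ≥0∞} (hw : ∀ x, w x ≠ ∞) :
    ∀ o x, nearestWeight τ w o x ≠ ∞
  | none, x => hw x
  | some q, x => by by_cases hx : τ x < q <;> simp [nearestWeight, hx]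

variable {Ω : Type*} [MeasurableSpace Ω] [MeasurableSpace E] {P : Measure Ω}
  {Λ : Measure E} {X : ℕ → Ω → E} {τ : E → ℝ}

lemma forall_le_iff_tsum_indicator_Iio (a : ℝ) (t : ℕ → ℝ) :
    (∀ m, a ≤ t m) ↔
      ∀ q : ℚ, (q : ℝ) ≤ a → ∑' m, (Iio (q : ℝ)).indicator (1 : ℝ → ℝ≥0∞) (t m) = 0 := by
  simp only [ENNReal.tsum_eq_zero, indicator_apply_eq_zero, Pi.one_apply, one_ne_zero, mem_Iio,
    imp_false, not_lt]
  refine ⟨fun h q hq m => hq.trans (h m), fun h m => le_of_forall_lt fun r hr => ?_⟩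
  obtain ⟨q, hrq, hqa⟩ := exists_rat_btwn hr
  exact hrq.trans_le (h q hqa.le m)

lemma measurableSet_forall_le {f : E → ℝ} {h : ℕ → E → ℝ} (hf : Measurable f)
    (hh : ∀ m, Measurable (h m)) : MeasurableSet {x | ∀ m, f x ≤ h m x} := by
  rw [ofPred_forall]
  exact .iInter fun m => measurableSet_le hf (hh m)

lemma IsPPP.setLIntegral_forall_le_negExp (hX : IsPPP P Λ X)
    (hτ : Measurable τ) {g : E → ℝ≥0∞} (hg : Measurable g) (a : ℝ) :
    ∫⁻ ω in {ω | ∀ m, a ≤ τ (X m ω)}, negExp (∑' m, g (X m ω)) ∂P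
      = negExp (Λ {x | τ x < a} + ∫⁻ x in {x | a ≤ τ x}, (1 - negExp (g x)) ∂Λ) := by
  have hXm := hX.measurable
  have hlt : MeasurableSet {x | τ x < a} := measurableSet_lt hτ measurable_const
  have hge : {x | τ x < a}ᶜ = {x | a ≤ τ x} := by ext; simp
  have hle : MeasurableSet {ω | ∀ m, a ≤ τ (X m ω)} :=
    measurableSet_forall_le measurable_const fun m => hτ.comp (hXm m)
  classical
  let k : E → ℝ≥0∞ := {x | τ x < a}.piecewise (fun _ => ∞) g
  have hk : ∀ ω, {ω | ∀ m, a ≤ τ (X m ω)}.indicator (fun ω => negExp (∑' m, g (X m ω))) ω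
      = negExp (∑' m, k (X m ω)) := fun ω => by
    by_cases hω : ∀ m, a ≤ τ (X m ω)
    · simp [k, indicator_of_mem (show ω ∈ {ω | ∀ m, a ≤ τ (X m ω)} from hω), (hω _).not_gt]
    · obtain ⟨m, hm⟩ := not_forall.1 hω
      rw [indicator_of_notMem (show ω ∉ {ω | ∀ m, a ≤ τ (X m ω)} from hω), eq_comm,
        negExp_eq_zero_iff]
      exact ENNReal.tsum_eq_top_of_eq_top ⟨m, piecewise_eq_of_mem _ _ _ (not_le.1 hm)⟩
  rw [← lintegral_indicator hle, lintegral_congr hk,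
    hX.laplace k (.piecewise hlt measurable_const hg), ← lintegral_add_compl _ hlt, hge]
  congr 2
  · rw [setLIntegral_congr_fun (g := 1) hlt fun x hx => by simp [k, piecewise_eq_of_mem _ _ _ hx]]
    simp
  · refine setLIntegral_congr_fun (measurableSet_le measurable_const hτ) fun x hx => ?_
    have hkx : k x = g x := piecewise_eq_of_notMem _ _ _ (not_lt (α := ℝ).2 hx)
    exact congrArg (fun y => 1 - negExp y) hkx

variable [IsProbabilityMeasure P]

lemma IsPPP.lintegral_tsum_comp (hX : IsPPP P Λ X) {f : E → ℝ≥0∞}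
    (hf : Measurable f) : ∫⁻ ω, ∑' n, f (X n ω) ∂P = ∫⁻ x, f x ∂Λ := by
  simpa using hX.lintegral_tsum_mul_negExp (h := 0) hf measurable_zero

lemma IsPPP.ae_forall (hX : IsPPP P Λ X) {p : E → Prop}
    (hp : ∀ᵐ x ∂Λ, p x) : ∀ᵐ ω ∂P, ∀ n, p (X n ω) := by
  have hXm := hX.measurable
  obtain ⟨A, hpA, hA, hΛA⟩ := exists_measurable_superset_of_null (ae_iff.1 hp)
  have hcount : Measurable fun ω => ∑' n, A.indicator (1 : E → ℝ≥0∞) (X n ω) :=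
    Measurable.tsum fun n => (measurable_one.indicator hA).comp (hXm n)
  have hmean := hX.lintegral_tsum_comp (measurable_one.indicator hA)
  rw [lintegral_indicator_one hA, hΛA, lintegral_eq_zero_iff hcount] at hmean
  filter_upwards [hmean] with ω hω n
  by_contra hn
  have h := ENNReal.tsum_eq_zero.1 hω n
  rw [indicator_of_mem (hpA hn)] at h
  exact one_ne_zero h

lemma IsPPP.ae_finite_mem (hX : IsPPP P Λ X) {A : Set E}
    (hA : MeasurableSet A) (hΛA : Λ A ≠ ∞) : ∀ᵐ ω ∂P, {n | X n ω ∈ A}.Finite := by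
  have hXm := hX.measurable
  have hcount : Measurable fun ω => ∑' n, A.indicator (1 : E → ℝ≥0∞) (X n ω) :=
    Measurable.tsum fun n => (measurable_one.indicator hA).comp (hXm n)
  have hmean : ∫⁻ ω, ∑' n, A.indicator 1 (X n ω) ∂P = Λ A := by
    rw [hX.lintegral_tsum_comp (measurable_one.indicator hA), lintegral_indicator_one hA]
  filter_upwards [ae_lt_top hcount (hmean ▸ hΛA)] with ω hω
  refine (ENNReal.finite_const_le_of_tsum_ne_top hω.ne one_ne_zero).subset fun n hn => ?_
  simp [indicator_of_mem (show X n ω ∈ A from hn)]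

lemma measurable_nearestWeight (hτ : Measurable τ) {w : E → ℝ≥0∞} (hw : Measurable w) :
    ∀ o, Measurable (nearestWeight τ w o)
  | none => hw
  | some _ => (measurable_one.indicator measurableSet_Iio).comp hτ

lemma IsPPP.tsum_setLIntegral_nearest [SigmaFinite Λ] (hX : IsPPP P Λ X)
    (hτ : Measurable τ) {w : E → ℝ≥0∞} (hw : Measurable w) (hfin : ∀ x, w x ≠ ∞)
    {G : E → ℝ≥0∞ → ℝ≥0∞} (hG : Measurable (Function.uncurry G)) :
    ∑' n, ∫⁻ ω in {ω | ∀ m, τ (X n ω) ≤ τ (X m ω)}, G (X n ω) (sumExcept n fun m => w (X m ω)) ∂P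
      = ∫⁻ x, ∫⁻ ω in {ω | ∀ m, τ x ≤ τ (X m ω)}, G x (∑' m, w (X m ω)) ∂P ∂Λ := by
  have hXm := hX.measurable
  let p := nearestWeight τ w
  have hp : ∀ o, Measurable (p o) := measurable_nearestWeight hτ hw
  let A : Set (E × (Option ℚ → ℝ≥0∞)) := {y | ∀ q : ℚ, (q : ℝ) ≤ τ y.1 → y.2 (some q) = 0}
  let F : E × (Option ℚ → ℝ≥0∞) → ℝ≥0∞ := A.indicator fun y => G y.1 (y.2 none)
  have hA : MeasurableSet A := by
    simp only [A, ofPred_forall]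
    exact .iInter fun q => .imp (measurableSet_le measurable_const (by fun_prop))
      (measurableSet_eq_fun (by fun_prop) measurable_const)
  have hF : Measurable F :=
    (hG.comp (measurable_fst.prodMk ((measurable_pi_apply none).comp measurable_snd))).indicator hA
  have hnear : ∀ x ω, (x, fun o => ∑' m, p o (X m ω)) ∈ A ↔ ∀ m, τ x ≤ τ (X m ω) := fun x ω =>
    (forall_le_iff_tsum_indicator_Iio (τ x) fun m => τ (X m ω)).symm
  have hself : ∀ n ω, (X n ω, fun o => sumExcept n fun m => p o (X m ω)) ∈ A ↔
      ∀ m, τ (X n ω) ≤ τ (X m ω) := fun n ω => by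
    rw [← hnear]
    refine forall₂_congr fun q hq => ?_
    have hq' : p (some q) (X n ω) = 0 := indicator_of_notMem (notMem_Iio.2 hq) 1
    simp only
    rw [← add_sumExcept n, hq', zero_add]
  have hset : ∀ f : Ω → ℝ, Measurable f → MeasurableSet {ω | ∀ m, f ω ≤ τ (X m ω)} :=
    fun f hf => measurableSet_forall_le hf fun m => hτ.comp (hXm m)
  calc _ = ∑' n, ∫⁻ ω, F (X n ω, fun o => sumExcept n fun m => p o (X m ω)) ∂P := by
        refine tsum_congr fun n => ?_
        rw [← lintegral_indicator (hset (fun ω => τ (X n ω)) (hτ.comp (hXm n)))]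
        classical exact lintegral_congr fun ω => if_congr (hself n ω).symm rfl rfl
    _ = ∫⁻ x, ∫⁻ ω, F (x, fun o => ∑' m, p o (X m ω)) ∂P ∂Λ := by
        rw [← hX.lintegral_tsum_sumExcept hp (nearestWeight_ne_top τ hfin) hF,
          lintegral_tsum fun n => by fun_prop]
    _ = _ := by
        refine lintegral_congr fun x => ?_
        rw [← lintegral_indicator (hset _ measurable_const)]
        classical exact lintegral_congr fun ω => if_congr (hnear x ω) rfl rfl

lemma IsPPP.tsum_measure_nearest [SigmaFinite Λ] (hX : IsPPP P Λ X)
    (hτ : Measurable τ) {w : E → ℝ≥0∞} (hw : Measurable w) (hfin : ∀ x, w x ≠ ∞)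
    {C : Set (E × ℝ≥0∞)} (hC : MeasurableSet C) :
    ∑' n, P {ω | (∀ m, τ (X n ω) ≤ τ (X m ω)) ∧ (X n ω, sumExcept n fun m => w (X m ω)) ∈ C}
      = ∫⁻ x, P.restrict {ω | ∀ m, τ x ≤ τ (X m ω)} {ω | (x, ∑' m, w (X m ω)) ∈ C} ∂Λ := by
  have hXm := hX.measurable
  have h := hX.tsum_setLIntegral_nearest hτ hw hfin (G := fun y s => C.indicator 1 (y, s))
    (measurable_one.indicator hC)
  have hwm : ∀ m, Measurable fun ω => w (X m ω) := fun m => hw.comp (hXm m)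
  have hsum : Measurable fun ω => ∑' m, w (X m ω) := .tsum hwm
  convert h using 3 with n x
  · have hCn : MeasurableSet {ω | (X n ω, sumExcept n fun m => w (X m ω)) ∈ C} :=
      hC.preimage (by fun_prop)
    refine .trans ?_ (lintegral_indicator_one hCn).symm
    rw [Measure.restrict_apply hCn, inter_comm]
    rfl
  · exact (lintegral_indicator_one (hC.preimage (measurable_const.prodMk hsum))).symm

end NearestPoint

section HalfLine

/-- The intensity measure of a homogeneous Poisson process of intensity `c` on `(0, ∞)`. -/
noncomputable def halfLineIntensity (c : ℝ) : Measure ℝ :=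
  ENNReal.ofReal c • volume.restrict (Ioi 0)

instance (c : ℝ) : SigmaFinite (halfLineIntensity c) :=
  inferInstanceAs (SigmaFinite (c.toNNReal • volume.restrict (Ioi 0)))

lemma lintegral_halfLineIntensity (c : ℝ) (f : ℝ → ℝ≥0∞) :
    ∫⁻ u, f u ∂(halfLineIntensity c) = ENNReal.ofReal c * ∫⁻ u in Ioi 0, f u := by
  rw [halfLineIntensity, lintegral_smul_measure, smul_eq_mul]

lemma ae_pos_halfLineIntensity (c : ℝ) : ∀ᵐ u ∂(halfLineIntensity c), 0 < u :=
  Measure.ae_smul_measure (ae_restrict_mem measurableSet_Ioi) _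

lemma halfLineIntensity_Iio {c : ℝ} (hc : 0 ≤ c) (u : ℝ) :
    halfLineIntensity c (Iio u) = ENNReal.ofReal (c * u) := by
  simp [halfLineIntensity, Measure.restrict_apply, inter_comm (Iio u), Ioi_inter_Iio,
    ENNReal.ofReal_mul hc]

lemma lintegral_Ioi_exp_neg_mul {a : ℝ} (ha : 0 < a) (t : ℝ) :
    ∫⁻ x in Ioi t, ENNReal.ofReal (Real.exp (-(a * x)))
      = ENNReal.ofReal (Real.exp (-(a * t)) / a) := by
  have h := exp_neg_integrableOn_Ioi t ha
  simp only [neg_mul] at h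
  rw [← ofReal_integral_eq_lintegral_ofReal h (ae_of_all _ fun x => (Real.exp_pos _).le)]
  simp_rw [← neg_mul]
  rw [integral_exp_mul_Ioi (by linarith), neg_div_neg_eq]

variable {c : ℝ}

lemma lintegral_negExp_mul_halfLineIntensity (hc : 0 < c) :
    ∫⁻ u, negExp (ENNReal.ofReal (c * u)) ∂(halfLineIntensity c) = 1 := by
  have h : ∀ u ∈ Ioi (0 : ℝ),
      negExp (ENNReal.ofReal (c * u)) = ENNReal.ofReal (Real.exp (-(c * u))) :=
    fun u hu => negExp_ofReal (mul_pos hc hu).le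
  rw [lintegral_halfLineIntensity, setLIntegral_congr_fun measurableSet_Ioi h,
    lintegral_Ioi_exp_neg_mul hc, ← ENNReal.ofReal_mul hc.le]
  simp [hc.ne']

variable {Ω : Type*} [MeasurableSpace Ω] {P : Measure Ω} [IsProbabilityMeasure P]
  {T : ℕ → Ω → ℝ}

lemma IsPPP.tsum_setLIntegral_nearest_halfLine
    (hT : IsPPP P (halfLineIntensity c) T) (hc : 0 ≤ c) {f : ℝ → ℝ≥0∞}
    (hf : Measurable f) :
    ∑' n, ∫⁻ ω in {ω | ∀ m, T n ω ≤ T m ω}, f (T n ω) ∂P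
      = ∫⁻ u, f u * negExp (ENNReal.ofReal (c * u)) ∂(halfLineIntensity c) := by
  rw [hT.tsum_setLIntegral_nearest (τ := fun u => u) (w := 0) (G := fun u _ => f u) measurable_id
    measurable_zero (by simp) (hf.comp measurable_fst)]
  refine lintegral_congr fun u => ?_
  have h := hT.setLIntegral_forall_le_negExp measurable_id measurable_zero u
  simp only [Pi.zero_apply, tsum_zero, negExp_zero, tsub_self, lintegral_zero, add_zero, id] at h
  rw [lintegral_const, ← setLIntegral_one, ← halfLineIntensity_Iio hc]
  simpa [Iio_def] using congrArg (f u * ·) h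

lemma IsPPP.ae_pos (hT : IsPPP P (halfLineIntensity c) T) :
    ∀ᵐ ω ∂P, ∀ n, 0 < T n ω :=
  hT.ae_forall (ae_pos_halfLineIntensity c)

lemma IsPPP.ae_exists_nearest (hT : IsPPP P (halfLineIntensity c) T)
    (hc : 0 ≤ c) : ∀ᵐ ω ∂P, ∃ n, ∀ m, T n ω ≤ T m ω := by
  have hfin : ∀ᵐ ω ∂P, ∀ j : ℕ, {n | T n ω ∈ Iio (j : ℝ)}.Finite := ae_all_iff.2 fun j =>
    hT.ae_finite_mem measurableSet_Iio (halfLineIntensity_Iio hc j ▸ ENNReal.ofReal_ne_top)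
  filter_upwards [hfin] with ω hω
  obtain ⟨j, hj⟩ := exists_nat_gt (T 0 ω)
  obtain ⟨n, hn, hmin⟩ := exists_min_image _ (fun n => T n ω) (hω j) ⟨0, hj⟩
  exact ⟨n, fun m => (lt_or_ge (T m ω) j).elim (hmin m) fun h => hn.le.trans h⟩

lemma IsPPP.ae_existsUnique_nearest
    (hT : IsPPP P (halfLineIntensity c) T) (hc : 0 < c) :
    ∀ᵐ ω ∂P, ∃! n, ∀ m, T n ω ≤ T m ω := by
  have hTm := hT.measurable
  have hset : ∀ n, MeasurableSet {ω | ∀ m, T n ω ≤ T m ω} := fun n =>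
    measurableSet_forall_le (hTm n) hTm
  let C : Ω → ℝ≥0∞ := fun ω => ∑' n, {ω | ∀ m, T n ω ≤ T m ω}.indicator 1 ω
  have hC : ∀ ω, C ω = {n | ∀ m, T n ω ≤ T m ω}.encard := fun ω => by
    rw [← ENNReal.tsum_set_one, tsum_subtype _ fun _ => 1]
    rfl
  have hmean : ∫⁻ ω, C ω ∂P = 1 := by
    have h := hT.tsum_setLIntegral_nearest_halfLine hc.le (measurable_const (a := 1))
    rw [lintegral_tsum fun n => (measurable_one.indicator (hset n)).aemeasurable]
    simp_rw [lintegral_indicator (hset _)]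
    simpa [lintegral_negExp_mul_halfLineIntensity hc] using h
  have hone : ∀ᵐ ω ∂P, 1 ≤ C ω := by
    filter_upwards [hT.ae_exists_nearest hc.le] with ω ⟨n, hn⟩
    rw [hC, ← ENat.toENNReal_one, ENat.toENNReal_le, Set.one_le_encard_iff_nonempty]
    exact ⟨n, hn⟩
  have heq : (fun _ => 1) =ᵐ[P] C :=
    ae_eq_of_ae_le_of_lintegral_le hone (by simp)
      (Measurable.tsum fun n => measurable_one.indicator (hset n)).aemeasurable (by simp [hmean])
  filter_upwards [heq] with ω hω
  rw [hC, eq_comm, ← ENat.toENNReal_one, ENat.toENNReal_inj, encard_eq_one] at hω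
  obtain ⟨n, hn⟩ := hω
  exact ⟨n, hn.ge rfl, fun m hm => hn.le hm⟩

end HalfLine

section Fading

instance : IsProbabilityMeasure (expMeasure 1) := isProbabilityMeasure_expMeasure one_pos

lemma lintegral_expMeasure_one {f : ℝ → ℝ≥0∞} (hf : Measurable f) :
    ∫⁻ x, f x ∂(expMeasure 1) = ∫⁻ x in Ioi 0, ENNReal.ofReal (Real.exp (-x)) * f x := by
  have h : expMeasure 1 = volume.withDensity (exponentialPDF 1) := rfl
  have hm : Measurable (exponentialPDF 1) := (measurable_exponentialPDFReal 1).ennreal_ofReal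
  rw [h, lintegral_withDensity_eq_lintegral_mul _ hm hf, restrict_Ioi_eq_restrict_Ici,
    ← lintegral_indicator measurableSet_Ici]
  refine lintegral_congr fun x => ?_
  by_cases hx : 0 ≤ x
  · simp [indicator_of_mem (show x ∈ Ici 0 from hx), exponentialPDF_of_nonneg hx]
  · simp [hx, exponentialPDF_of_neg (not_le.1 hx)]

lemma expMeasure_one_lt_ofReal (Y : ℝ≥0∞) :
    expMeasure 1 {x | Y < ENNReal.ofReal x} = negExp Y := by
  induction Y using ENNReal.recTopCoe with
  | top => simp
  | coe y =>
    have hs : {x : ℝ | (y : ℝ≥0∞) < ENNReal.ofReal x} = Ioi (y : ℝ) := by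
      ext x
      rw [← ENNReal.ofReal_coe_nnreal]
      exact ENNReal.ofReal_lt_ofReal_iff_of_nonneg y.coe_nonneg
    have hdens : ∀ x, ENNReal.ofReal (Real.exp (-x)) * (Ioi (y : ℝ)).indicator 1 x
        = (Ioi (y : ℝ)).indicator (fun x => ENNReal.ofReal (Real.exp (-(1 * x)))) x := fun x => by
      by_cases hx : x ∈ Ioi (y : ℝ) <;> simp [hx]
    rw [hs, ← lintegral_indicator_one measurableSet_Ioi,
      lintegral_expMeasure_one (measurable_one.indicator measurableSet_Ioi)]
    simp_rw [hdens]
    rw [lintegral_indicator measurableSet_Ioi, Measure.restrict_restrict measurableSet_Ioi,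
      inter_eq_self_of_subset_left (Ioi_subset_Ioi y.coe_nonneg), lintegral_Ioi_exp_neg_mul one_pos,
      one_mul, div_one, ← negExp_ofReal y.coe_nonneg, ENNReal.ofReal_coe_nnreal]

lemma ae_pos_expMeasure_one : ∀ᵐ x ∂(expMeasure 1), 0 < x :=
  (mem_ae_iff_prob_eq_one measurableSet_Ioi).2 <| by
    simpa [Ioi_def] using expMeasure_one_lt_ofReal 0

lemma lintegral_rpow_expMeasure_one {p : ℝ} (hp : 0 < p) :
    ∫⁻ x, ENNReal.ofReal (x ^ p) ∂(expMeasure 1) = ENNReal.ofReal (Real.Gamma (p + 1)) := by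
  have hI := Real.GammaIntegral_convergent (s := p + 1) (by linarith)
  rw [lintegral_expMeasure_one (by fun_prop), Real.Gamma_eq_integral (by linarith),
    ofReal_integral_eq_lintegral_ofReal hI]
  · refine setLIntegral_congr_fun measurableSet_Ioi fun x _ => ?_
    rw [← ENNReal.ofReal_mul (Real.exp_nonneg _), add_sub_cancel_right]
  · filter_upwards [ae_restrict_mem measurableSet_Ioi] with x hx
    exact mul_nonneg (Real.exp_nonneg _) (Real.rpow_nonneg (le_of_lt hx) _)

lemma lintegral_negExp_mul_expMeasure_one {a : ℝ} (ha : 0 ≤ a) :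
    ∫⁻ x, negExp (ENNReal.ofReal a * ENNReal.ofReal x) ∂(expMeasure 1)
      = ENNReal.ofReal (1 / (1 + a)) := by
  have hdens : ∀ x ∈ Ioi (0 : ℝ), ENNReal.ofReal (Real.exp (-x))
      * negExp (ENNReal.ofReal a * ENNReal.ofReal x)
        = ENNReal.ofReal (Real.exp (-((1 + a) * x))) := fun x hx => by
    have hx : (0 : ℝ) < x := hx
    rw [← ENNReal.ofReal_mul ha, negExp_ofReal (by positivity),
      ← ENNReal.ofReal_mul (Real.exp_nonneg _), ← Real.exp_add]
    ring_nf
  rw [lintegral_expMeasure_one (by fun_prop), setLIntegral_congr_fun measurableSet_Ioi hdens,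
    lintegral_Ioi_exp_neg_mul (by linarith)]
  simp

lemma lintegral_one_sub_negExp_mul_expMeasure_one {a : ℝ} (ha : 0 ≤ a) :
    ∫⁻ x, (1 - negExp (ENNReal.ofReal a * ENNReal.ofReal x)) ∂(expMeasure 1)
      = ENNReal.ofReal (a / (1 + a)) := by
  rw [lintegral_sub (by fun_prop) (by simp [lintegral_negExp_mul_expMeasure_one ha])
    (ae_of_all _ fun x => negExp_le_one _), lintegral_negExp_mul_expMeasure_one ha]
  rw [lintegral_one, measure_univ, ← ENNReal.ofReal_one, ← ENNReal.ofReal_sub _ (by positivity)]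
  congr 1
  field_simp
  ring

end Fading

section Rho

lemma integrableOn_one_div_one_add_rpow {a : ℝ} (ha : 1 < a) :
    IntegrableOn (fun ν : ℝ => 1 / (1 + ν ^ a)) (Ioi 0) := by
  have hm : Measurable fun ν : ℝ => 1 / (1 + ν ^ a) := by fun_prop
  have h0 : IntegrableOn (fun ν : ℝ => 1 / (1 + ν ^ a)) (Ioc 0 1) := by
    refine Integrable.mono' (g := fun _ => 1) (integrableOn_const (by simp) (by simp))
      hm.aestronglyMeasurable ?_
    filter_upwards [ae_restrict_mem measurableSet_Ioc] with ν hν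
    have : 0 < ν ^ a := Real.rpow_pos_of_pos hν.1 _
    rw [Real.norm_of_nonneg (by positivity), div_le_one (by positivity)]
    linarith
  have h1 : IntegrableOn (fun ν : ℝ => 1 / (1 + ν ^ a)) (Ioi 1) := by
    refine Integrable.mono' (integrableOn_Ioi_rpow_of_lt (a := -a) (by linarith) one_pos)
      hm.aestronglyMeasurable ?_
    filter_upwards [ae_restrict_mem measurableSet_Ioi] with ν hν
    have h0 : (0 : ℝ) < ν := one_pos.trans hν
    have : 0 < ν ^ a := Real.rpow_pos_of_pos h0 _
    rw [Real.norm_of_nonneg (by positivity), Real.rpow_neg h0.le, one_div]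
    exact inv_anti₀ this (by linarith)
  simpa [Ioc_union_Ioi_eq_Ioi] using h0.union h1

lemma lintegral_Ioi_one_div_one_add_rpow {a t : ℝ} (ha : 1 < a) (ht : 0 ≤ t) :
    ∫⁻ ν in Ioi t, ENNReal.ofReal (1 / (1 + ν ^ a))
      = ENNReal.ofReal (∫ ν in Ioi t, 1 / (1 + ν ^ a)) := by
  rw [ofReal_integral_eq_lintegral_ofReal
    ((integrableOn_one_div_one_add_rpow ha).mono_set (Ioi_subset_Ioi ht))]
  filter_upwards [ae_restrict_mem measurableSet_Ioi] with ν hν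
  have h0 : (0 : ℝ) < ν := ht.trans_lt hν
  simp only [Pi.zero_apply]
  positivity

lemma rhoInf_pos {α : ℝ} (hα : 2 < α) : 0 < rhoInf α := by
  rw [rhoInf, setIntegral_pos_iff_support_of_nonneg_ae]
  · refine lt_of_lt_of_le (b := volume (Ioi (0 : ℝ))) (by simp) (measure_mono fun x hx => ⟨?_, hx⟩)
    have : 0 < x ^ (α / 2) := Real.rpow_pos_of_pos hx _
    simp only [Function.mem_support]
    positivity
  · filter_upwards [ae_restrict_mem measurableSet_Ioi] with ν hν
    have h0 : (0 : ℝ) < ν := hν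
    simp only [Pi.zero_apply]
    positivity
  · exact integrableOn_one_div_one_add_rpow (by linarith)

lemma rho_nonneg {α β : ℝ} (hβ : 0 ≤ β) : 0 ≤ rho α β := by
  refine setIntegral_nonneg measurableSet_Ioi fun ν hν => ?_
  have h0 : (0 : ℝ) ≤ ν := (Real.rpow_nonneg hβ _).trans (le_of_lt hν)
  positivity

lemma lintegral_Ioi_comp_mul (F : ℝ → ℝ≥0∞) {a : ℝ} (ha : 0 < a) (t : ℝ) :
    ∫⁻ u in Ioi t, F (a * u) = ENNReal.ofReal a⁻¹ * ∫⁻ u in Ioi (a * t), F u := by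
  have he : MeasurableEmbedding (fun u : ℝ => a * u) :=
    (Homeomorph.mulLeft₀ a ha.ne').measurableEmbedding
  have hpre : (fun u : ℝ => a * u) ⁻¹' Ioi (a * t) = Ioi t := by
    ext u
    exact mul_lt_mul_iff_right₀ ha
  have hvol : (volume : Measure ℝ).map (a * ·) = ENNReal.ofReal a⁻¹ • volume := by
    rw [Real.map_volume_mul_left ha.ne', abs_of_pos (inv_pos.2 ha)]
  rw [← smul_eq_mul, ← lintegral_smul_measure, ← Measure.restrict_smul, ← hvol, he.restrict_map,
    he.lintegral_map, hpre]

end Rho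

section Signal

lemma mul_rpow_rpow_div_two {α β z : ℝ} (hα : α ≠ 0) (hβ : 0 ≤ β) (hz : 0 ≤ z) :
    (β * z ^ (α / 2)) ^ (2 / α) = β ^ (2 / α) * z := by
  rw [Real.mul_rpow hβ (Real.rpow_nonneg hz _), ← Real.rpow_mul hz,
    div_mul_div_cancel₀ two_ne_zero, div_self hα, Real.rpow_one]

/-- Intensity measure of the marked process of base stations seen by a receiver: the position on
the half-line encodes transmit power and distance, the independent mark is the Rayleigh fading. -/
noncomputable def fadingIntensity (c : ℝ) : Measure (ℝ × ℝ) :=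
  (halfLineIntensity c).prod (expMeasure 1)

instance (c : ℝ) : SigmaFinite (fadingIntensity c) :=
  inferInstanceAs (SigmaFinite ((halfLineIntensity c).prod (expMeasure 1)))

/-- The power received from a base station at position `q.1` of the half-line with fading `q.2`. -/
noncomputable def signal (α : ℝ) (q : ℝ × ℝ) : ℝ≥0∞ :=
  ENNReal.ofReal (q.1 ^ (-(α / 2)) * q.2)

@[fun_prop] lemma measurable_signal (α : ℝ) : Measurable (signal α) := by
  unfold signal; fun_prop

variable {α c κ : ℝ}

lemma ofReal_mul_signal (hκ : 0 ≤ κ) {u : ℝ} (hu : 0 < u) (x : ℝ) :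
    ENNReal.ofReal κ * signal α (u, x) =
      ENNReal.ofReal (κ * u ^ (-(α / 2))) * ENNReal.ofReal x := by
  have hu' : 0 ≤ u ^ (-(α / 2)) := by positivity
  rw [signal, ENNReal.ofReal_mul hu', ENNReal.ofReal_mul hκ, mul_assoc]

lemma lintegral_one_sub_negExp_mul_signal_expMeasure (hα : α ≠ 0) (hκ : 0 < κ) {u : ℝ}
    (hu : 0 < u) :
    ∫⁻ x, (1 - negExp (ENNReal.ofReal κ * signal α (u, x))) ∂(expMeasure 1)
      = ENNReal.ofReal (1 / (1 + (κ ^ (-2 / α) * u) ^ (α / 2))) := by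
  simp_rw [ofReal_mul_signal hκ.le hu]
  rw [lintegral_one_sub_negExp_mul_expMeasure_one (by positivity),
    Real.mul_rpow (by positivity) hu.le, ← Real.rpow_mul hκ.le,
    show -2 / α * (α / 2) = -1 by field_simp, Real.rpow_neg_one, Real.rpow_neg hu.le]
  congr 1
  field_simp
  ring

lemma lintegral_Ici_one_sub_negExp_mul_signal (hα : 2 < α) (hc : 0 ≤ c) (hκ : 0 < κ) {t : ℝ}
    (ht : 0 ≤ t) :
    ∫⁻ q in {q : ℝ × ℝ | t ≤ q.1}, (1 - negExp (ENNReal.ofReal κ * signal α q))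
        ∂(fadingIntensity c)
      = ENNReal.ofReal (c * (κ ^ (2 / α)
          * ∫ ν in Ioi (κ ^ (-2 / α) * t), 1 / (1 + ν ^ (α / 2)))) := by
  have hset : {q : ℝ × ℝ | t ≤ q.1} = Ici t ×ˢ univ := by ext; simp
  have hae : (Ici t ∩ Ioi 0 : Set ℝ) =ᵐ[volume] Ioi t := by
    have h := Ioi_ae_eq_Ici (a := t) (μ := volume).symm.inter (ae_eq_refl (Ioi (0 : ℝ)))
    rwa [inter_eq_self_of_subset_left (Ioi_subset_Ioi ht)] at h
  have hk : 0 < κ ^ (-2 / α) := Real.rpow_pos_of_pos hκ _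
  rw [hset, fadingIntensity, ← Measure.prod_restrict, Measure.restrict_univ,
    lintegral_prod _ (by fun_prop), halfLineIntensity, Measure.restrict_smul,
    lintegral_smul_measure, smul_eq_mul, Measure.restrict_restrict measurableSet_Ici,
    setLIntegral_congr hae, setLIntegral_congr_fun measurableSet_Ioi fun u hu =>
      lintegral_one_sub_negExp_mul_signal_expMeasure (by linarith) hκ (ht.trans_lt hu),
    lintegral_Ioi_comp_mul (fun u => ENNReal.ofReal (1 / (1 + u ^ (α / 2)))) hk,
    lintegral_Ioi_one_div_one_add_rpow (by linarith) (by positivity),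
    ← ENNReal.ofReal_mul (by positivity), ← ENNReal.ofReal_mul hc, ← Real.rpow_neg hκ.le,
    neg_div, neg_neg]

variable {Ω : Type*} [MeasurableSpace Ω] {P : Measure Ω} {Y : ℕ → Ω → ℝ × ℝ}

lemma IsPPP.lintegral_negExp_mul_tsum_signal
    (hY : IsPPP P (fadingIntensity c) Y) (hα : 2 < α) (hc : 0 ≤ c) (hκ : 0 < κ) :
    ∫⁻ ω, negExp (ENNReal.ofReal κ * ∑' n, signal α (Y n ω)) ∂P
      = negExp (ENNReal.ofReal (c * (κ ^ (2 / α) * rhoInf α))) := by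
  have hpos : ∀ᵐ q ∂(fadingIntensity c), q ∈ {q : ℝ × ℝ | 0 ≤ q.1} :=
    Measure.quasiMeasurePreserving_fst.ae ((ae_pos_halfLineIntensity c).mono fun _ h => h.le)
  simp_rw [← ENNReal.tsum_mul_left]
  rw [hY.laplace (fun q => ENNReal.ofReal κ * signal α q) (by fun_prop),
    ← Measure.restrict_eq_self_of_ae_mem hpos,
    lintegral_Ici_one_sub_negExp_mul_signal hα hc hκ le_rfl, mul_zero, rhoInf]

end Signal

section Coverage

variable {Ω : Type*} [MeasurableSpace Ω] {P : Measure Ω} {Y : ℕ → Ω → ℝ × ℝ} {α β c : ℝ}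

/-- The event that the `n`-th point of `q.1` is a nearest one, and that its signal exceeds `β` times
the sum of the signals of all other points and of the additional interference `q.2`. -/
def nearestCovered (α β : ℝ) (n : ℕ) : Set ((ℕ → ℝ × ℝ) × ℝ≥0∞) :=
  {q | (∀ m, (q.1 n).1 ≤ (q.1 m).1) ∧
    ENNReal.ofReal β * (sumExcept n (fun m => signal α (q.1 m)) + q.2) < signal α (q.1 n)}

lemma measurableSet_nearestCovered (n : ℕ) : MeasurableSet (nearestCovered α β n) := by
  have hf : ∀ m, Measurable fun q : (ℕ → ℝ × ℝ) × ℝ≥0∞ => signal α (q.1 m) := by fun_prop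
  exact (measurableSet_forall_le (by fun_prop) fun m => by fun_prop).inter
    (measurableSet_lt (by fun_prop) (hf n))

lemma expMeasure_one_mul_lt_signal (β : ℝ) {u : ℝ} (hu : 0 < u) (s : ℝ≥0∞) :
    expMeasure 1 {x | ENNReal.ofReal β * s < signal α (u, x)}
      = negExp (ENNReal.ofReal (β * u ^ (α / 2)) * s) := by
  have hp : 0 < u ^ (α / 2) := Real.rpow_pos_of_pos hu _
  rw [← expMeasure_one_lt_ofReal]
  congr 1
  ext x
  have hsig : ENNReal.ofReal (u ^ (α / 2)) * signal α (u, x) = ENNReal.ofReal x := by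
    rw [signal, ← ENNReal.ofReal_mul hp.le, Real.rpow_neg hu.le, mul_inv_cancel_left₀ hp.ne']
  rw [mem_ofPred_eq, mem_ofPred_eq, ← hsig, mul_comm β, ENNReal.ofReal_mul hp.le, mul_assoc,
    ENNReal.mul_lt_mul_iff_right (ENNReal.ofReal_pos.2 hp).ne' ENNReal.ofReal_ne_top]

lemma IsPPP.setLIntegral_forall_le_negExp_signal
    (hY : IsPPP P (fadingIntensity c) Y) (hα : 2 < α) (hc : 0 ≤ c) (hβ : 0 < β)
    {u : ℝ} (hu : 0 < u) :
    ∫⁻ ω in {ω | ∀ m, u ≤ (Y m ω).1},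
        negExp (ENNReal.ofReal (β * u ^ (α / 2)) * ∑' m, signal α (Y m ω)) ∂P
      = negExp (ENNReal.ofReal (c * u * (1 + β ^ (2 / α) * rho α β))) := by
  have hκ : 0 < β * u ^ (α / 2) := by positivity
  have hvoid : fadingIntensity c {q | q.1 < u} = ENNReal.ofReal (c * u) := by
    rw [← halfLineIntensity_Iio hc, show {q : ℝ × ℝ | q.1 < u} = Iio u ×ˢ univ by ext; simp,
      fadingIntensity, Measure.prod_prod, measure_univ, mul_one]
  have hpow := mul_rpow_rpow_div_two (by positivity : α ≠ 0) hβ.le hu.le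
  have hrho : (β * u ^ (α / 2)) ^ (-2 / α) * u = β ^ (-2 / α) := by
    rw [neg_div, Real.rpow_neg hκ.le, hpow, mul_inv, inv_mul_cancel_right₀ hu.ne',
      Real.rpow_neg hβ.le]
  simp_rw [← ENNReal.tsum_mul_left]
  rw [hY.setLIntegral_forall_le_negExp measurable_fst
      (g := fun q => ENNReal.ofReal (β * u ^ (α / 2)) * signal α q) (by fun_prop), hvoid,
    lintegral_Ici_one_sub_negExp_mul_signal hα hc hκ hu.le, hrho, hpow, ← rho,
    ← ENNReal.ofReal_add (by positivity) (by have := rho_nonneg (α := α) hβ.le; positivity)]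
  ring_nf

lemma lintegral_prod_measure_restrict_forall_le {F G : Type*} [MeasurableSpace F]
    [MeasurableSpace G] [SFinite P] {Λ : Measure ℝ} {ν : Measure F} [SFinite ν]
    {T : ℕ → Ω → ℝ} (hT : ∀ m, Measurable (T m)) {Z : Ω → G} (hZ : Measurable Z)
    {C : Set ((ℝ × F) × G)} (hC : MeasurableSet C) :
    ∫⁻ q, P.restrict {ω | ∀ m, q.1 ≤ T m ω} {ω | (q, Z ω) ∈ C} ∂(Λ.prod ν)
      = ∫⁻ u, ∫⁻ ω in {ω | ∀ m, u ≤ T m ω}, ν {x | ((u, x), Z ω) ∈ C} ∂P ∂Λ := by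
  have hjoint : MeasurableSet {p : (ℝ × F) × Ω | (∀ m, p.1.1 ≤ T m p.2) ∧ (p.1, Z p.2) ∈ C} :=
    (measurableSet_forall_le (by fun_prop) fun m => by fun_prop).inter (hC.preimage (by fun_prop))
  have hmeas : Measurable fun q : ℝ × F =>
      P.restrict {ω | ∀ m, q.1 ≤ T m ω} {ω | (q, Z ω) ∈ C} := by
    have h := measurable_measure_prodMk_left (ν := P) hjoint
    refine (congrArg Measurable (funext fun q => ?_)).mpr h
    exact (Measure.restrict_apply (hC.preimage (by fun_prop))).trans (congrArg P (inter_comm _ _))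
  rw [lintegral_prod _ hmeas.aemeasurable]
  refine lintegral_congr fun u => ?_
  have hD : MeasurableSet {p : F × Ω | ((u, p.1), Z p.2) ∈ C} := hC.preimage (by fun_prop)
  let Q := P.restrict {ω | ∀ m, u ≤ T m ω}
  exact (Measure.prod_apply (ν := Q) hD).symm.trans (Measure.prod_apply_symm hD)

variable [IsProbabilityMeasure P]

lemma IsPPP.tsum_measure_nearestCovered
    (hY : IsPPP P (fadingIntensity c) Y) (hα : 2 < α) (hc : 0 ≤ c) (hβ : 0 < β)
    (d : ℝ≥0∞) :
    ∑' n, P {ω | (fun m => Y m ω, d) ∈ nearestCovered α β n}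
      = ∫⁻ u, negExp (ENNReal.ofReal (β * u ^ (α / 2)) * d)
          * negExp (ENNReal.ofReal (c * u * (1 + β ^ (2 / α) * rho α β)))
          ∂(halfLineIntensity c) := by
  have hYm := hY.measurable
  let C : Set ((ℝ × ℝ) × ℝ≥0∞) := {q | ENNReal.ofReal β * (q.2 + d) < signal α q.1}
  have hC : MeasurableSet C := measurableSet_lt (by fun_prop) (by fun_prop)
  calc _ = ∫⁻ q, P.restrict {ω | ∀ m, q.1 ≤ (Y m ω).1} {ω | (q, ∑' m, signal α (Y m ω)) ∈ C}
          ∂(fadingIntensity c) :=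
        hY.tsum_measure_nearest measurable_fst (measurable_signal α)
          (fun _ => ENNReal.ofReal_ne_top) hC
    _ = ∫⁻ u, ∫⁻ ω in {ω | ∀ m, u ≤ (Y m ω).1},
          expMeasure 1 {x | ((u, x), ∑' m, signal α (Y m ω)) ∈ C} ∂P ∂(halfLineIntensity c) :=
        lintegral_prod_measure_restrict_forall_le (fun m => (hYm m).fst) (by fun_prop) hC
    _ = _ := by
        refine lintegral_congr_ae ?_
        filter_upwards [ae_pos_halfLineIntensity c] with u hu
        have hu' : 0 < u := hu
        simp only [C, mem_ofPred_eq, expMeasure_one_mul_lt_signal β hu']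
        simp only [mul_add (ENNReal.ofReal (β * _)), negExp_add]
        rw [lintegral_mul_const _ (by fun_prop),
          hY.setLIntegral_forall_le_negExp_signal hα hc hβ hu, mul_comm]

lemma IsPPP.tsum_measure_nearestCovered_of_indepFun
    (hY : IsPPP P (fadingIntensity c) Y) {J : Ω → ℝ≥0∞} (hJ : Measurable J)
    (hJY : IndepFun J (fun ω n => Y n ω) P) (hα : 2 < α) (hc : 0 ≤ c) (hβ : 0 < β) :
    ∑' n, P {ω | (fun m => Y m ω, J ω) ∈ nearestCovered α β n}
      = ∫⁻ u, (∫⁻ ω, negExp (ENNReal.ofReal (β * u ^ (α / 2)) * J ω) ∂P)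
          * negExp (ENNReal.ofReal (c * u * (1 + β ^ (2 / α) * rho α β)))
          ∂(halfLineIntensity c) := by
  have hYm : Measurable fun ω n => Y n ω := measurable_pi_lambda _ hY.measurable
  have hcov := fun n => measurableSet_nearestCovered (α := α) (β := β) n
  have hone : ∀ n, Measurable (Function.uncurry fun (d : ℝ≥0∞) (y : ℕ → ℝ × ℝ) =>
      (nearestCovered α β n).indicator 1 (y, d) : _ → ℝ≥0∞) := fun n =>
    (measurable_one.indicator (hcov n)).comp measurable_swap
  calc _ = ∑' n, ∫⁻ ω, P {ω' | (fun m => Y m ω', J ω) ∈ nearestCovered α β n} ∂P := by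
        refine tsum_congr fun n => ?_
        have h := lintegral_of_indepFun hJ hYm hJY (hone n)
        have hmeas : MeasurableSet {ω | (fun m => Y m ω, J ω) ∈ nearestCovered α β n} :=
          (hcov n).preimage (hYm.prodMk hJ)
        refine (lintegral_indicator_one hmeas).symm.trans (h.trans (lintegral_congr fun ω => ?_))
        exact lintegral_indicator_one ((hcov n).preimage (hYm.prodMk measurable_const))
    _ = ∫⁻ ω, ∫⁻ u, negExp (ENNReal.ofReal (β * u ^ (α / 2)) * J ω)
          * negExp (ENNReal.ofReal (c * u * (1 + β ^ (2 / α) * rho α β)))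
          ∂(halfLineIntensity c) ∂P := by
        rw [← lintegral_tsum]
        · simp_rw [hY.tsum_measure_nearestCovered hα hc hβ]
        · intro n
          have hsw : Measurable fun p : ℝ≥0∞ × Ω => (fun m => Y m p.2, p.1) :=
            (hYm.comp measurable_snd).prodMk measurable_fst
          exact ((measurable_measure_prodMk_left (hsw (hcov n))).comp hJ).aemeasurable
    _ = _ := by
        rw [lintegral_lintegral_swap (by fun_prop)]
        exact lintegral_congr fun u => lintegral_mul_const _ (by fun_prop)

end Coverage

section PathLoss

lemma volume_norm_sub_sq_le (x₀ : Plane) (b : ℝ) :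
    volume {x : Plane | ‖x - x₀‖ ^ 2 ≤ b} = ENNReal.ofReal (Real.pi * b) := by
  rcases lt_or_ge b 0 with hb | hb
  · rw [ENNReal.ofReal_of_nonpos (mul_nonpos_of_nonneg_of_nonpos Real.pi_nonneg hb.le),
      show {x : Plane | ‖x - x₀‖ ^ 2 ≤ b} = ∅ from
        eq_empty_of_forall_notMem fun x => (hb.trans_le (sq_nonneg _)).not_ge, measure_empty]
  · have hball : {x : Plane | ‖x - x₀‖ ^ 2 ≤ b} = Metric.closedBall x₀ √b := by
      ext x
      rw [mem_ofPred_eq, mem_closedBall_iff_norm, Real.le_sqrt (norm_nonneg _) hb]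
    rw [hball, EuclideanSpace.volume_closedBall_fin_two, ← ENNReal.ofReal_pow (Real.sqrt_nonneg _),
      Real.sq_sqrt hb, mul_comm, ENNReal.ofReal_mul Real.pi_nonneg]

lemma map_norm_sub_sq_volume (x₀ : Plane) :
    (volume : Measure Plane).map (fun x => ‖x - x₀‖ ^ 2) = halfLineIntensity Real.pi := by
  have hm : Measurable fun x : Plane => ‖x - x₀‖ ^ 2 := by fun_prop
  have hIic : ∀ b, (volume : Measure Plane).map (fun x => ‖x - x₀‖ ^ 2) (Iic b)
      = ENNReal.ofReal (Real.pi * b) := fun b =>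
    (Measure.map_apply hm measurableSet_Iic).trans (volume_norm_sub_sq_le x₀ b)
  have hIic' : ∀ b, halfLineIntensity Real.pi (Iic b) = ENNReal.ofReal (Real.pi * b) := fun b => by
    simp [halfLineIntensity, Measure.restrict_apply, inter_comm (Iic b), Ioi_inter_Iic,
      ENNReal.ofReal_mul Real.pi_nonneg]
  have hfin : IsLocallyFiniteMeasure (halfLineIntensity Real.pi) :=
    isLocallyFiniteMeasureSMulNNReal _ Real.pi.toNNReal
  refine (Measure.ext_of_Ioc _ _ fun a b hab => ?_).symm
  rw [← Iic_sdiff_Iic, measure_sdiff (Iic_subset_Iic.2 hab.le) nullMeasurableSet_Iic,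
    measure_sdiff (Iic_subset_Iic.2 hab.le) nullMeasurableSet_Iic, hIic, hIic, hIic', hIic']
  · exact hIic a ▸ ENNReal.ofReal_ne_top
  · exact hIic' a ▸ ENNReal.ofReal_ne_top

lemma lintegral_comp_mul_norm_sub_sq {F : ℝ → ℝ≥0∞} (hF : Measurable F) {a : ℝ} (ha : 0 < a)
    (x₀ : Plane) :
    ∫⁻ x : Plane, F (a * ‖x - x₀‖ ^ 2) = ENNReal.ofReal (Real.pi * a⁻¹) * ∫⁻ u in Ioi 0, F u := by
  rw [← lintegral_map (μ := volume) (f := fun u => F (a * u)) (by fun_prop)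
      (show Measurable fun x : Plane => ‖x - x₀‖ ^ 2 by fun_prop), map_norm_sub_sq_volume,
    lintegral_halfLineIntensity, lintegral_Ioi_comp_mul F ha, mul_zero, ← mul_assoc,
    ← ENNReal.ofReal_mul Real.pi_nonneg]

/-- The quantity `(M n * ‖X n - x₀‖ ^ (-α)) ^ (-2 / α)`, decreasing in the average power that `x₀`
receives from the `n`-th point with transmit power `M n`. The exponent makes these quantities a
Poisson process of constant intensity on the half-line. -/
noncomputable def lossPoint {Ω : Type*} (α : ℝ) (x₀ : Plane) (M : ℕ → Ω → ℝ) (X : ℕ → Ω → Plane)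
    (n : ℕ) (ω : Ω) : ℝ :=
  M n ω ^ (-(2 / α)) * ‖X n ω - x₀‖ ^ 2

lemma lossPoint_rpow {Ω : Type*} {α : ℝ} (hα : 0 < α) {x₀ : Plane} {M : ℕ → Ω → ℝ}
    {X : ℕ → Ω → Plane} {n : ℕ} {ω : Ω} (hM : 0 ≤ M n ω) :
    lossPoint α x₀ M X n ω ^ (-(α / 2)) = M n ω * ‖X n ω - x₀‖ ^ (-α) := by
  rw [lossPoint, Real.mul_rpow (by positivity) (by positivity), ← Real.rpow_mul hM,
    ← Real.rpow_natCast, ← Real.rpow_mul (norm_nonneg _)]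
  congr 1
  · rw [show -(2 / α) * -(α / 2) = 1 by field_simp, Real.rpow_one]
  · congr 1; push_cast; ring

lemma measurable_lossPoint {Ω : Type*} {_ : MeasurableSpace Ω} {α : ℝ} {x₀ : Plane}
    {M : ℕ → Ω → ℝ} {X : ℕ → Ω → Plane} {n : ℕ} (hM : Measurable (M n)) (hX : Measurable (X n)) :
    Measurable (lossPoint α x₀ M X n) :=
  (hM.pow_const _).mul ((hX.sub_const _).norm.pow_const _)

lemma map_lossPoint_prod {ν : Measure ℝ} [SFinite ν] {lam m α : ℝ} (hlam : 0 ≤ lam)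
    (hν : ∀ᵐ p ∂ν, 0 < p) (hm : ∫⁻ p, ENNReal.ofReal (p ^ (2 / α)) ∂ν = ENNReal.ofReal m)
    (x₀ : Plane) :
    ((ENNReal.ofReal lam • (volume : Measure Plane)).prod ν).map
        (fun q => q.2 ^ (-(2 / α)) * ‖q.1 - x₀‖ ^ 2) = halfLineIntensity (Real.pi * lam * m) := by
  refine Measure.ext_of_lintegral _ fun F hF => ?_
  have hinner : ∀ p : ℝ, 0 < p →
      ∫⁻ x : Plane, F (p ^ (-(2 / α)) * ‖x - x₀‖ ^ 2) ∂(ENNReal.ofReal lam • volume)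
        = ENNReal.ofReal (Real.pi * lam) * (∫⁻ u in Ioi 0, F u) * ENNReal.ofReal (p ^ (2 / α)) :=
    fun p hp => by
      rw [lintegral_smul_measure, lintegral_comp_mul_norm_sub_sq hF (Real.rpow_pos_of_pos hp _),
        Real.rpow_neg hp.le, inv_inv, smul_eq_mul, ENNReal.ofReal_mul Real.pi_nonneg,
        ENNReal.ofReal_mul Real.pi_nonneg]
      ring
  rw [lintegral_map hF (by fun_prop), lintegral_prod_symm _ (by fun_prop),
    lintegral_congr_ae (hν.mono hinner), lintegral_const_mul _ (by fun_prop), hm,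
    lintegral_halfLineIntensity, ENNReal.ofReal_mul (mul_nonneg Real.pi_nonneg hlam)]
  ring

variable {Ω : Type*} [MeasurableSpace Ω] {P : Measure Ω} [IsProbabilityMeasure P]
  {lam m : ℝ} {X : ℕ → Ω → Plane} {M : ℕ → Ω → ℝ} {ν : Measure ℝ}

lemma IsHomogeneousPPP.isPPP_lossPoint (hX : IsHomogeneousPPP P lam X) (hlam : 0 ≤ lam)
    (hM : ∀ n, Measurable (M n)) (hMi : iIndepFun M P) (hMν : ∀ n, P.map (M n) = ν)
    (hν : ∀ᵐ p ∂ν, 0 < p) (hXM : IndepFun (fun ω n => X n ω) (fun ω n => M n ω) P)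
    {α : ℝ} (hm : ∫⁻ p, ENNReal.ofReal (p ^ (2 / α)) ∂ν = ENNReal.ofReal m) (x₀ : Plane) :
    IsPPP P (halfLineIntensity (Real.pi * lam * m)) (lossPoint α x₀ M X) := by
  have : IsProbabilityMeasure ν := hMν 0 ▸ Measure.isProbabilityMeasure_map (hM 0).aemeasurable
  have hmap := (hX.isPPP.mark hM hMi hMν hXM).map
    (φ := fun q : Plane × ℝ => q.2 ^ (-(2 / α)) * ‖q.1 - x₀‖ ^ 2) (by fun_prop)
  rwa [map_lossPoint_prod hlam hν hm] at hmap

end PathLoss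

section IndependentSources

variable {Ω ι E F : Type*} [mE : MeasurableSpace E] [MeasurableSpace F]
  {m : ι → MeasurableSpace Ω} {s t : Set ι}

lemma measurable_biSup_of_comap_le {i : ι} (hi : i ∈ s) {f : Ω → E}
    (h : MeasurableSpace.comap f mE ≤ m i) : Measurable[⨆ i ∈ s, m i] f :=
  measurable_iff_comap_le.2 (h.trans (le_iSup₂_of_le i hi le_rfl))

lemma measurable_biSup_of_forall_comap_le {i : ℕ → ι} (hi : ∀ n, i n ∈ s) {f : ℕ → Ω → E}
    (h : ∀ n, MeasurableSpace.comap (f n) mE ≤ m (i n)) :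
    Measurable[⨆ i ∈ s, m i] fun ω n => f n ω :=
  @measurable_pi_lambda _ _ _ (⨆ i ∈ s, m i) _ _ fun n =>
    measurable_biSup_of_comap_le (hi n) (h n)

variable [mΩ : MeasurableSpace Ω] {P : Measure Ω}

lemma indepFun_of_iIndep_of_disjoint (hle : ∀ i, m i ≤ mΩ) (h : iIndep m P) (hst : Disjoint s t)
    {f : Ω → E} {g : Ω → F} (hf : Measurable[⨆ i ∈ s, m i] f)
    (hg : Measurable[⨆ i ∈ t, m i] g) : IndepFun f g P := by
  rw [IndepFun_iff_Indep]
  exact indep_of_indep_of_le_left (indep_of_indep_of_le_right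
    (indep_iSup_of_disjoint hle h hst) hg.comap_le) hf.comap_le

lemma iIndepFun_of_iIndep_fiber [IsProbabilityMeasure P] {κ : Type*} {op : ι → κ}
    (hle : ∀ i, m i ≤ mΩ) (h : iIndep m P) {f : κ → Ω → E}
    (hf : ∀ o, Measurable[⨆ i ∈ op ⁻¹' {o}, m i] (f o)) : iIndepFun f P := by
  classical
  rw [iIndepFun_iff_measure_inter_preimage_eq_mul]
  intro S A hA
  induction S using Finset.induction_on with
  | empty => simp
  | insert o S ho ih =>
    have hS : ∀ j ∈ S, MeasurableSet[⨆ i ∈ op ⁻¹' S, m i] (f j ⁻¹' A j) := fun j hj =>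
      (hf j).mono (biSup_mono fun i (hi : op i = j) => Finset.mem_coe.2 (hi.symm ▸ hj)) le_rfl
        (hA j (Finset.mem_insert_of_mem hj))
    have hdisj : Disjoint (op ⁻¹' {o}) (op ⁻¹' S) :=
      Disjoint.preimage _ (disjoint_singleton_left.2 ho)
    rw [Finset.set_biInter_insert, Finset.prod_insert ho,
      (Indep_iff _ _ P).1 (indep_iSup_of_disjoint hle h hdisj) _ _
        (hf o (hA o (Finset.mem_insert_self o S))) (S.measurableSet_biInter hS),
      ih fun j hj => hA j (Finset.mem_insert_of_mem hj)]

end IndependentSources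

section ReferencePower

lemma lintegral_mul_negExp_halfLineIntensity_ne_top {c : ℝ} (hc : 0 < c) (a : ℝ) :
    ∫⁻ u, ENNReal.ofReal (a * u) * negExp (ENNReal.ofReal (c * u)) ∂(halfLineIntensity c) ≠ ∞ := by
  have hint :=
    (integrableOn_rpow_mul_exp_neg_mul_rpow (s := 1) (by norm_num) one_pos hc).const_mul a
  rw [lintegral_halfLineIntensity]
  refine ENNReal.mul_ne_top ENNReal.ofReal_ne_top ?_
  rw [setLIntegral_congr_fun measurableSet_Ioi fun u (hu : 0 < u) => ?_]
  · exact hint.lintegral_lt_top.ne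
  · simp only [Real.rpow_one]
    rw [negExp_ofReal (mul_pos hc hu).le, ← ENNReal.ofReal_mul' (Real.exp_nonneg _), neg_mul,
      mul_assoc]

variable {S B Ω : Type*} {N : Params S B} {R : Network N Ω}

/-- The points on the half-line that describe the interference from the reference base station at
the users of the seller owning `l`. -/
noncomputable def Network.refPoint (R : Network N Ω) (l : N.Band) : ℕ → Ω → ℝ :=
  lossPoint N.α R.refSite (R.refGain l) (R.userS l.1)

/-- The intensity of the points `R.refPoint l`. -/
noncomputable def refIntensity (N : Params S B) (l : N.Band) : ℝ :=
  Real.pi * N.muS l.1 * Real.Gamma (2 / N.α + 1)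

lemma refIntensity_pos (l : N.Band) : 0 < refIntensity N l := by
  have := N.α_gt
  have := N.muS_pos l.1
  have := Real.Gamma_pos_of_pos (s := 2 / N.α + 1) (by positivity)
  unfold refIntensity
  positivity

lemma Network.refPow_pos_and_rpow_eq {l : N.Band} {ω : Ω} (hgain : ∀ n, 0 < R.refGain l n ω)
    (hpos : ∀ n, 0 < R.refPoint l n ω) {n : ℕ} (hn : ∀ m, R.refPoint l n ω ≤ R.refPoint l m ω) :
    0 < R.refPow l ω ∧ R.refPow l ω ^ (2 / N.α) = N.ζ l.1 ^ (2 / N.α) * R.refPoint l n ω := by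
  have hα := N.α_gt
  have hζ := N.ζ_pos l.1
  have hgreatest : IsGreatest (range fun m => R.refPoint l m ω ^ (-(N.α / 2)))
      (R.refPoint l n ω ^ (-(N.α / 2))) := ⟨⟨n, rfl⟩, forall_mem_range.2 fun m =>
    Real.rpow_le_rpow_of_nonpos (hpos n) (hn m) (by linarith)⟩
  have hH : R.refH l ω = R.refPoint l n ω ^ (-(N.α / 2)) := by
    rw [← hgreatest.csSup_eq]
    refine iSup_congr fun m => ?_
    rw [Network.refPoint, lossPoint_rpow (by linarith) (hgain m).le, norm_sub_rev]
  have hHpos : 0 < R.refH l ω := hH ▸ Real.rpow_pos_of_pos (hpos n) _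
  refine ⟨div_pos hζ hHpos, ?_⟩
  rw [Network.refPow, Real.div_rpow hζ.le hHpos.le, hH, ← Real.rpow_mul (hpos n).le,
    show -(N.α / 2) * (2 / N.α) = -1 by field_simp, Real.rpow_neg_one, div_inv_eq_mul]

variable [MeasurableSpace Ω] {P : Measure Ω}

lemma Network.IsModel.refSigma_le (hR : R.IsModel P) (l : N.Band) (i : Option ℕ) :
    R.refSigma l i ≤ (inferInstance : MeasurableSpace Ω) := by
  cases i with
  | none => exact (measurable_pi_lambda _ (hR.userS_ppp l.1).measurable).comap_le
  | some i => exact (hR.refGain_meas l i).comap_le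

lemma Network.IsModel.measurable_refPow (hR : R.IsModel P) (l : N.Band) :
    Measurable (R.refPow l) := by
  have hgain := hR.refGain_meas l
  have huser := (hR.userS_ppp l.1).measurable
  unfold Network.refPow Network.refH
  fun_prop

lemma Network.IsModel.ae_refGain_pos (hR : R.IsModel P) (l : N.Band) :
    ∀ᵐ ω ∂P, ∀ n, 0 < R.refGain l n ω :=
  ae_all_iff.2 fun n => ((hR.refGain_law l n).ae_iff measurableSet_Ioi.mem).2 ae_pos_expMeasure_one

variable [IsProbabilityMeasure P]

lemma Network.IsModel.isPPP_refPoint (hR : R.IsModel P) (l : N.Band) :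
    IsPPP P (halfLineIntensity (refIntensity N l)) (R.refPoint l) := by
  have hα := N.α_gt
  have hind : IndepFun (fun ω n => R.userS l.1 n ω) (fun ω n => R.refGain l n ω) P :=
    indepFun_of_iIndep_of_disjoint (hR.refSigma_le l) (hR.ref_indep l)
      (s := {none}) (t := range some) (by simp)
      (measurable_biSup_of_comap_le (m := R.refSigma l) (mem_singleton none) le_rfl)
      (measurable_biSup_of_forall_comap_le (m := R.refSigma l) (i := some)
        mem_range_self fun n => le_rfl)
  have hgain : iIndepFun (R.refGain l) P := (hR.ref_indep l).precomp (Option.some_injective ℕ)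
  exact (hR.userS_ppp l.1).isPPP_lossPoint (N.muS_pos _).le (hR.refGain_meas l) hgain
    (fun n => (hR.refGain_law l n).map_eq) ae_pos_expMeasure_one hind
    (lintegral_rpow_expMeasure_one (by positivity)) _

lemma Network.IsModel.ae_refPow (hR : R.IsModel P) (l : N.Band) :
    ∀ᵐ ω ∂P, 0 < R.refPow l ω ∧ ∃ n, (∀ m, R.refPoint l n ω ≤ R.refPoint l m ω) ∧
      R.refPow l ω ^ (2 / N.α) = N.ζ l.1 ^ (2 / N.α) * R.refPoint l n ω := by
  have hT := hR.isPPP_refPoint l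
  filter_upwards [hT.ae_exists_nearest (refIntensity_pos l).le, hR.ae_refGain_pos l, hT.ae_pos]
    with ω ⟨n, hn⟩ hgain hpos
  exact (R.refPow_pos_and_rpow_eq hgain hpos hn).imp_right fun h => ⟨n, hn, h⟩

lemma Network.IsModel.integrable_refPow_rpow (hR : R.IsModel P) (l : N.Band) :
    Integrable (fun ω => R.refPow l ω ^ (2 / N.α)) P := by
  have hT := hR.isPPP_refPoint l
  have hTm := hT.measurable
  let A : ℕ → Set Ω := fun n => {ω | ∀ m, R.refPoint l n ω ≤ R.refPoint l m ω}
  have hA : ∀ n, MeasurableSet (A n) := fun n => measurableSet_forall_le (hTm n) hTm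
  have hnn : 0 ≤ᵐ[P] fun ω => R.refPow l ω ^ (2 / N.α) :=
    (hR.ae_refPow l).mono fun ω hω => (Real.rpow_pos_of_pos hω.1 _).le
  refine (lintegral_ofReal_ne_top_iff_integrable
    ((hR.measurable_refPow l).pow_const _).aestronglyMeasurable hnn).1 (ne_top_of_le_ne_top
      (lintegral_mul_negExp_halfLineIntensity_ne_top (refIntensity_pos l)
        (N.ζ l.1 ^ (2 / N.α))) ?_)
  calc ∫⁻ ω, ENNReal.ofReal (R.refPow l ω ^ (2 / N.α)) ∂P
      ≤ ∫⁻ ω, ∑' n, (A n).indicator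
          (fun ω => ENNReal.ofReal (N.ζ l.1 ^ (2 / N.α) * R.refPoint l n ω)) ω ∂P := by
        refine lintegral_mono_ae ?_
        filter_upwards [hR.ae_refPow l] with ω ⟨_, n, hn, hω⟩
        refine le_of_eq_of_le ?_ (ENNReal.le_tsum n)
        rw [indicator_of_mem (show ω ∈ A n from hn), hω]
    _ = ∑' n, ∫⁻ ω in A n, ENNReal.ofReal (N.ζ l.1 ^ (2 / N.α) * R.refPoint l n ω) ∂P := by
        rw [lintegral_tsum fun n => (Measurable.indicator (by fun_prop) (hA n)).aemeasurable]
        simp_rw [lintegral_indicator (hA _)]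
    _ = _ := hT.tsum_setLIntegral_nearest_halfLine (refIntensity_pos l).le
        (f := fun u => ENNReal.ofReal (N.ζ l.1 ^ (2 / N.α) * u)) (by fun_prop)

lemma Network.IsModel.powMoment_pos (hR : R.IsModel P) (l : N.Band) : 0 < R.powMoment P l := by
  have hpos : ∀ᵐ ω ∂P, 0 < R.refPow l ω ^ (2 / N.α) :=
    (hR.ae_refPow l).mono fun ω hω => Real.rpow_pos_of_pos hω.1 _
  have hsupp : Function.support (fun ω => R.refPow l ω ^ (2 / N.α)) =ᵐ[P] univ :=
    eventuallyEq_univ.2 (hpos.mono fun ω h => h.ne')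
  rw [Network.powMoment, integral_pos_iff_support_of_nonneg_ae (hpos.mono fun ω h => h.le)
    (hR.integrable_refPow_rpow l), measure_congr hsupp, measure_univ]
  exact one_pos

lemma Network.IsModel.lintegral_refPow_rpow (hR : R.IsModel P) (l : N.Band) :
    ∫⁻ p, ENNReal.ofReal (p ^ (2 / N.α)) ∂(P.map (R.refPow l))
      = ENNReal.ofReal (R.powMoment P l) := by
  rw [lintegral_map (by fun_prop) (hR.measurable_refPow l), Network.powMoment,
    ofReal_integral_eq_lintegral_ofReal (hR.integrable_refPow_rpow l)]
  exact (hR.ae_refPow l).mono fun ω hω => (Real.rpow_pos_of_pos hω.1 _).le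

end ReferencePower

lemma iIndepFun_const {Ω ι E : Type*} [MeasurableSpace Ω] [MeasurableSpace E] {P : Measure Ω}
    [IsProbabilityMeasure P] (x : ι → E) : iIndepFun (fun i (_ : Ω) => x i) P := by
  classical
  rw [iIndepFun_iff_measure_inter_preimage_eq_mul]
  intro s A hA
  induction s using Finset.induction_on with
  | empty => simp
  | insert i s hi ih =>
    rw [Finset.set_biInter_insert, Finset.prod_insert hi,
      ← ih fun j hj => hA j (Finset.mem_insert_of_mem hj)]
    by_cases h : x i ∈ A i <;> simp [h]

section Operators

/-- The operator whose base stations a source of randomness belongs to: `none` stands for the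
seller that owns the sub-band and `some k` for the buyer `k`. -/
@[simp] def Source.operator {B : Type*} : Source B → Option B
  | .sellerSites => none
  | .buyerSites k => some k
  | .sellerGain _ => none
  | .buyerGain k _ => some k
  | .buyerPower k _ => some k

/-- The source of randomness that is the channel gain of the `n`-th base station of an operator. -/
@[simp] def Source.ofGain {B : Type*} : Option B → ℕ → Source B
  | none => .sellerGain
  | some k => .buyerGain k

lemma Source.operator_ofGain {B : Type*} (o : Option B) (n : ℕ) : (ofGain o n).operator = o := by
  cases o <;> rfl

lemma Source.ofGain_injective {B : Type*} (o : Option B) : Function.Injective (ofGain o) := by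
  cases o <;> simp [Function.Injective]

variable {S B Ω : Type*} {N : Params S B} {R : Network N Ω} {l : N.Band} {o : Option B}

/-- The locations of the base stations of an operator of the sub-band `l`. -/
def Network.site (R : Network N Ω) (l : N.Band) : Option B → ℕ → Ω → Plane
  | none => R.siteS l.1
  | some k => R.siteB k

/-- The transmit powers of the base stations of an operator on the sub-band `l`. -/
def Network.power (R : Network N Ω) (l : N.Band) : Option B → ℕ → Ω → ℝ
  | none => fun _ _ => N.PS
  | some k => R.powB l k

/-- The channel gains between the typical user and the base stations of an operator on the sub-band
`l`. -/
def Network.gain (R : Network N Ω) (l : N.Band) : Option B → ℕ → Ω → ℝ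
  | none => R.gainS l
  | some k => R.gainB l k

/-- The points on the half-line that describe the average powers received from an operator. -/
noncomputable def Network.point (R : Network N Ω) (l : N.Band) (o : Option B) : ℕ → Ω → ℝ :=
  lossPoint N.α 0 (R.power l o) (R.site l o)

/-- The points `R.point l o` marked with the channel gains. -/
noncomputable def Network.fadingPoint (R : Network N Ω) (l : N.Band) (o : Option B) (n : ℕ)
    (ω : Ω) : ℝ × ℝ :=
  (R.point l o n ω, R.gain l o n ω)

/-- The intensity of the points `R.point l o`. -/
noncomputable def Network.pointIntensity [MeasurableSpace Ω] (R : Network N Ω) (P : Measure Ω)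
    (l : N.Band) : Option B → ℝ
  | none => Real.pi * N.lamS l.1 * N.PS ^ (2 / N.α)
  | some k => Real.pi * N.lamB k * R.powMoment P l

lemma Network.comap_gain_eq_sourceSigma (n : ℕ) :
    MeasurableSpace.comap (R.gain l o n) inferInstance = R.sourceSigma l (.ofGain o n) := by
  cases o <;> rfl

lemma Network.measurable_gain_biSup (R : Network N Ω) (l : N.Band) (o : Option B) :
    Measurable[⨆ i ∈ range (Source.ofGain o), R.sourceSigma l i] fun ω n => R.gain l o n ω :=
  measurable_biSup_of_forall_comap_le (m := R.sourceSigma l) mem_range_self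
    fun n => (R.comap_gain_eq_sourceSigma n).le

lemma Network.measurable_point_biSup (R : Network N Ω) (l : N.Band) (o : Option B) :
    Measurable[⨆ i ∈ Source.operator ⁻¹' {o} \ range (Source.ofGain o), R.sourceSigma l i]
      fun ω n => R.point l o n ω := by
  have hle : ∀ i ∉ range (Source.ofGain i.operator), R.sourceSigma l i
      ≤ ⨆ j ∈ Source.operator ⁻¹' {i.operator} \ range (Source.ofGain i.operator),
        R.sourceSigma l j :=
    fun i hi => le_iSup₂_of_le i ⟨rfl, hi⟩ le_rfl
  refine @measurable_pi_lambda _ _ _ (⨆ i ∈ _ \ _, R.sourceSigma l i) _ _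
    fun n => measurable_lossPoint ?_ ?_
  · cases o with
    | none => exact measurable_const
    | some k =>
      exact measurable_iff_comap_le.2 (hle (.buyerPower k n) (by simp))
  · cases o with
    | none =>
      exact (measurable_pi_apply n).comp
        (measurable_iff_comap_le.2 (hle .sellerSites (by simp)))
    | some k =>
      exact (measurable_pi_apply n).comp
        (measurable_iff_comap_le.2 (hle (.buyerSites k) (by simp)))

lemma Network.measurable_fadingPoint_biSup (R : Network N Ω) (l : N.Band) (o : Option B) :
    Measurable[⨆ i ∈ Source.operator ⁻¹' {o}, R.sourceSigma l i]
      fun ω n => R.fadingPoint l o n ω := by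
  have hpoint : Measurable[⨆ i ∈ Source.operator ⁻¹' {o}, R.sourceSigma l i]
      fun ω n => R.point l o n ω :=
    (R.measurable_point_biSup l o).mono (biSup_mono fun i hi => hi.1) le_rfl
  have hgain : Measurable[⨆ i ∈ Source.operator ⁻¹' {o}, R.sourceSigma l i]
      fun ω n => R.gain l o n ω :=
    (R.measurable_gain_biSup l o).mono
      (biSup_mono (forall_mem_range.2 (Source.operator_ofGain o))) le_rfl
  exact @measurable_pi_lambda _ _ _ (⨆ i ∈ _, R.sourceSigma l i) _ _ fun n =>
    ((measurable_pi_apply n).comp hpoint).prodMk ((measurable_pi_apply n).comp hgain)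

variable [mΩ : MeasurableSpace Ω] {P : Measure Ω}

lemma Network.IsModel.sourceSigma_le (hR : R.IsModel P) (l : N.Band) (i : Source B) :
    R.sourceSigma l i ≤ mΩ := by
  cases i with
  | sellerSites => exact (measurable_pi_lambda _ (hR.siteS_ppp l.1).measurable).comap_le
  | buyerSites k => exact (measurable_pi_lambda _ (hR.siteB_ppp k).measurable).comap_le
  | sellerGain n => exact (hR.gainS_meas l n).comap_le
  | buyerGain k n => exact (hR.gainB_meas l k n).comap_le
  | buyerPower k n => exact (hR.powB_meas l k n).comap_le

lemma Network.IsModel.measurable_fadingPoint (hR : R.IsModel P) (l : N.Band) (o : Option B)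
    (n : ℕ) : Measurable (R.fadingPoint l o n) :=
  (measurable_pi_apply n).comp ((R.measurable_fadingPoint_biSup l o).mono
    (iSup₂_le fun i _ => hR.sourceSigma_le l i) le_rfl)

lemma Network.IsModel.hasLaw_gain (hR : R.IsModel P) (ho : o ∈ (N.lessees l).insertNone) (n : ℕ) :
    HasLaw (R.gain l o n) (expMeasure 1) P := by
  cases o with
  | none => exact hR.gainS_law l n
  | some k => exact hR.gainB_law l k (Finset.some_mem_insertNone.1 ho) n

lemma Network.IsModel.measurable_gain (hR : R.IsModel P) (n : ℕ) : Measurable (R.gain l o n) :=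
  (hR.measurable_fadingPoint l o n).snd

variable [IsProbabilityMeasure P]

lemma Network.IsModel.iIndepFun_fadingPoint (hR : R.IsModel P) (l : N.Band) :
    iIndepFun (fun o ω n => R.fadingPoint l o n ω) P :=
  iIndepFun_of_iIndep_fiber (hR.sourceSigma_le l) (hR.indep l) (R.measurable_fadingPoint_biSup l)

lemma Network.IsModel.isPPP_point (hR : R.IsModel P)
    (ho : o ∈ (N.lessees l).insertNone) :
    IsPPP P (halfLineIntensity (R.pointIntensity P l o)) (R.point l o) := by
  cases o with
  | none =>
    exact (hR.siteS_ppp l.1).isPPP_lossPoint (N.lamS_pos _).le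
      (fun _ => measurable_const) (iIndepFun_const _) (ν := .dirac N.PS)
      (fun _ => by simp) ((ae_dirac_iff measurableSet_Ioi).2 N.PS_pos)
      (indepFun_const_right _ _) (lintegral_dirac' _ (by fun_prop)) 0
  | some k =>
    have hk := Finset.some_mem_insertNone.1 ho
    have hind : IndepFun (fun ω n => R.siteB k n ω) (fun ω n => R.powB l k n ω) P :=
      indepFun_of_iIndep_of_disjoint (hR.sourceSigma_le l) (hR.indep l)
        (s := {.buyerSites k}) (t := range (.buyerPower k)) (by simp)
        (measurable_biSup_of_comap_le (m := R.sourceSigma l) (mem_singleton _) le_rfl)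
        (measurable_biSup_of_forall_comap_le (m := R.sourceSigma l) mem_range_self fun n => le_rfl)
    exact (hR.siteB_ppp k).isPPP_lossPoint (N.lamB_pos k).le (hR.powB_meas l k)
      ((hR.indep l).precomp fun n m h => Source.buyerPower.inj h |>.2)
      (fun n => (hR.powB_law l k hk n).map_eq)
      ((ae_map_iff (hR.measurable_refPow l).aemeasurable measurableSet_Ioi).2
        ((hR.ae_refPow l).mono fun ω hω => hω.1)) hind (hR.lintegral_refPow_rpow l) 0

lemma Network.IsModel.isPPP_fadingPoint (hR : R.IsModel P)
    (ho : o ∈ (N.lessees l).insertNone) :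
    IsPPP P (fadingIntensity (R.pointIntensity P l o)) (R.fadingPoint l o) := by
  have hgain : iIndepFun (R.gain l o) P := (iIndepFun_iff_iIndep _ _ _).2 <| by
    simp_rw [R.comap_gain_eq_sourceSigma]
    exact (hR.indep l).precomp (Source.ofGain_injective o)
  have hind : IndepFun (fun ω n => R.point l o n ω) (fun ω n => R.gain l o n ω) P :=
    indepFun_of_iIndep_of_disjoint (hR.sourceSigma_le l) (hR.indep l) disjoint_sdiff_left
      (R.measurable_point_biSup l o) (R.measurable_gain_biSup l o)
  exact (hR.isPPP_point ho).mark hR.measurable_gain hgain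
    (fun n => (hR.hasLaw_gain ho n).map_eq) hind

end Operators

section Signal

lemma signal_ne_top (α : ℝ) (q : ℝ × ℝ) : signal α q ≠ ∞ := ENNReal.ofReal_ne_top

lemma sumExcept_le_tsum (n : ℕ) (f : ℕ → ℝ≥0∞) : sumExcept n f ≤ ∑' m, f m :=
  add_sumExcept n f ▸ le_add_self

lemma toReal_sumExcept {n : ℕ} {f : ℕ → ℝ≥0∞} (hf : ∀ m, f m ≠ ∞) :
    (sumExcept n f).toReal = ∑' m, if m = n then 0 else (f m).toReal := by
  rw [sumExcept, ENNReal.tsum_toReal_eq fun m => by split_ifs <;> simp [hf m]]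
  simp_rw [apply_ite ENNReal.toReal, ENNReal.toReal_zero]

lemma IsPPP.ae_tsum_signal_ne_top {Ω : Type*} [MeasurableSpace Ω] {P : Measure Ω}
    [IsProbabilityMeasure P] {Y : ℕ → Ω → ℝ × ℝ} {α c : ℝ}
    (hY : IsPPP P (fadingIntensity c) Y) (hα : 2 < α) (hc : 0 ≤ c) :
    ∀ᵐ ω ∂P, ∑' n, signal α (Y n ω) ≠ ∞ := by
  have hYm := hY.measurable
  have hmeas : MeasurableSet {ω | ∑' n, signal α (Y n ω) ≠ ∞} :=
    (measurableSet_singleton ∞).compl.preimage (by fun_prop)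
  have hle : ∀ κ : ℝ, 0 < κ → negExp (ENNReal.ofReal (c * (κ ^ (2 / α) * rhoInf α)))
      ≤ P {ω | ∑' n, signal α (Y n ω) ≠ ∞} := fun κ hκ => by
    rw [← hY.lintegral_negExp_mul_tsum_signal hα hc hκ, ← lintegral_indicator_one hmeas]
    refine lintegral_mono fun ω => ?_
    by_cases h : ∑' n, signal α (Y n ω) = ∞
    · simp [h, ENNReal.mul_top, hκ]
    · rw [indicator_of_mem (by exact h)]
      exact negExp_le_one _
  have hlim : Tendsto (fun κ : ℝ => negExp (ENNReal.ofReal (c * (κ ^ (2 / α) * rhoInf α))))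
      (𝓝[>] 0) (𝓝 1) := by
    have hrpow : Continuous fun κ : ℝ => κ ^ (2 / α) := Real.continuous_rpow_const (by positivity)
    have hcont : Continuous fun κ : ℝ => negExp (ENNReal.ofReal (c * (κ ^ (2 / α) * rhoInf α))) :=
      continuous_negExp.comp (ENNReal.continuous_ofReal.comp (by fun_prop))
    convert (hcont.tendsto 0).mono_left nhdsWithin_le_nhds using 2
    rw [Real.zero_rpow (by positivity)]
    simp
  have hone : 1 ≤ P {ω | ∑' n, signal α (Y n ω) ≠ ∞} :=
    le_of_tendsto hlim (eventually_mem_nhdsWithin.mono hle)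
  exact mem_ae_iff.2 ((prob_compl_eq_zero_iff hmeas).2 (prob_le_one.antisymm hone))

end Signal

section Sinr

variable {S B Ω : Type*} {N : Params S B} {R : Network N Ω} {l : N.Band} {o : Option B} {b : B}
  {n : ℕ} {ω : Ω}

/-- The total power received from an operator on the sub-band `l`. -/
noncomputable def Network.totalSignal (R : Network N Ω) (l : N.Band) (o : Option B) (ω : Ω) :
    ℝ≥0∞ :=
  ∑' n, signal N.α (R.fadingPoint l o n ω)

lemma Network.power_mul_norm_site_rpow (hp : 0 ≤ R.power l o n ω) :
    R.power l o n ω * ‖R.site l o n ω‖ ^ (-N.α) = R.point l o n ω ^ (-(N.α / 2)) := by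
  have hα := N.α_gt
  rw [Network.point, lossPoint_rpow (by linarith) hp, sub_zero]

lemma Network.toReal_signal_fadingPoint (hp : 0 ≤ R.power l o n ω) (hg : 0 ≤ R.gain l o n ω) :
    (signal N.α (R.fadingPoint l o n ω)).toReal
      = R.power l o n ω * R.gain l o n ω * ‖R.site l o n ω‖ ^ (-N.α) := by
  rw [signal, Network.fadingPoint, ← R.power_mul_norm_site_rpow hp,
    ENNReal.toReal_ofReal (by positivity), mul_right_comm]

lemma Network.toReal_totalSignal (hp : ∀ n, 0 ≤ R.power l o n ω) (hg : ∀ n, 0 ≤ R.gain l o n ω) :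
    (R.totalSignal l o ω).toReal
      = ∑' n, R.power l o n ω * R.gain l o n ω * ‖R.site l o n ω‖ ^ (-N.α) := by
  rw [Network.totalSignal, ENNReal.tsum_toReal_eq fun n => signal_ne_top _ _]
  exact tsum_congr fun n => R.toReal_signal_fadingPoint (hp n) (hg n)

lemma Network.serving_eq (hp : ∀ n, 0 ≤ R.powB l b n ω) (hpos : ∀ n, 0 < R.point l (some b) n ω)
    (hn : ∀ m, R.point l (some b) n ω ≤ R.point l (some b) m ω)
    (huniq : ∃! n, ∀ m, R.point l (some b) n ω ≤ R.point l (some b) m ω) :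
    R.serving l b ω = n := by
  have hα := N.α_gt
  have havg : ∀ k, R.avgRecv l b k ω = R.point l (some b) k ω ^ (-(N.α / 2)) := fun k =>
    R.power_mul_norm_site_rpow (o := some b) (hp k)
  have hset : {k | ∀ m, R.avgRecv l b m ω ≤ R.avgRecv l b k ω} = {n} := by
    simp_rw [havg, Real.rpow_le_rpow_iff_of_neg (hpos _) (hpos _)
      (show -(N.α / 2) < 0 by linarith)]
    exact Subset.antisymm (fun k hk => huniq.unique hk hn) (singleton_subset_iff.2 hn)
  rw [Network.serving, hset, csInf_singleton]

variable [DecidableEq B]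

/-- The noise power together with the total power received from all operators other than `b`. -/
noncomputable def Network.externalNoise (R : Network N Ω) (l : N.Band) (b : B) (ω : Ω) : ℝ≥0∞ :=
  ∑ o ∈ ((N.lessees l).erase b).insertNone, R.totalSignal l o ω + ENNReal.ofReal (N.σ ^ 2)

/-- The interference and noise experienced by the typical user of `b` when it is served by the
`n`-th base station. -/
noncomputable def Network.interferenceNoise (R : Network N Ω) (l : N.Band) (b : B) (n : ℕ) (ω : Ω) :
    ℝ≥0∞ :=
  sumExcept n (fun m => signal N.α (R.fadingPoint l (some b) m ω)) + R.externalNoise l b ω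

lemma insertNone_erase_subset {s : Finset B} : (s.erase b).insertNone ⊆ s.insertNone :=
  Finset.insertNone.monotone (Finset.erase_subset b s)

lemma Network.interferenceNoise_ne_top (hb : b ∈ N.lessees l)
    (hfin : ∀ o ∈ (N.lessees l).insertNone, R.totalSignal l o ω ≠ ∞) :
    R.interferenceNoise l b n ω ≠ ∞ := by
  refine ENNReal.add_ne_top.2 ⟨ne_top_of_le_ne_top (hfin _ (Finset.some_mem_insertNone.2 hb))
    (sumExcept_le_tsum n _), ENNReal.add_ne_top.2 ⟨ENNReal.sum_ne_top.2 fun o ho => ?_,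
    ENNReal.ofReal_ne_top⟩⟩
  exact hfin o (insertNone_erase_subset ho)

lemma Network.interferenceNoise_ne_zero (hg : 0 < R.gainS l 0 ω)
    (hpos : 0 < R.point l none 0 ω) : R.interferenceNoise l b n ω ≠ 0 := by
  have hsignal : signal N.α (R.fadingPoint l none 0 ω) ≠ 0 :=
    (ENNReal.ofReal_pos.2 (mul_pos (Real.rpow_pos_of_pos hpos _) hg)).ne'
  have hle : signal N.α (R.fadingPoint l none 0 ω) ≤ R.interferenceNoise l b n ω :=
    calc signal N.α (R.fadingPoint l none 0 ω) ≤ R.totalSignal l none ω := ENNReal.le_tsum 0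
      _ ≤ ∑ o ∈ ((N.lessees l).erase b).insertNone, R.totalSignal l o ω :=
        Finset.single_le_sum_of_canonicallyOrdered (f := fun o => R.totalSignal l o ω)
          Finset.none_mem_insertNone
      _ ≤ R.externalNoise l b ω := le_self_add
      _ ≤ R.interferenceNoise l b n ω := le_add_self
  exact ((pos_iff_ne_zero.2 hsignal).trans_le hle).ne'

lemma Network.toReal_interferenceNoise (hb : b ∈ N.lessees l)
    (hfin : ∀ o ∈ (N.lessees l).insertNone, R.totalSignal l o ω ≠ ∞)
    (hp : ∀ o ∈ (N.lessees l).insertNone, ∀ n, 0 ≤ R.power l o n ω)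
    (hg : ∀ o ∈ (N.lessees l).insertNone, ∀ n, 0 ≤ R.gain l o n ω) (hn : R.serving l b ω = n) :
    (R.interferenceNoise l b n ω).toReal = R.interference l b ω + N.σ ^ 2 := by
  have hbl : some b ∈ (N.lessees l).insertNone := Finset.some_mem_insertNone.2 hb
  have hother : ∀ o ∈ ((N.lessees l).erase b).insertNone, (R.totalSignal l o ω).toReal
      = ∑' n, R.power l o n ω * R.gain l o n ω * ‖R.site l o n ω‖ ^ (-N.α) := fun o ho =>
    R.toReal_totalSignal (hp o (insertNone_erase_subset ho)) (hg o (insertNone_erase_subset ho))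
  have hown : (sumExcept n fun m => signal N.α (R.fadingPoint l (some b) m ω)).toReal
      = ∑' m, if m = n then 0 else R.recvB l b m ω := by
    rw [toReal_sumExcept fun m => signal_ne_top _ _]
    exact tsum_congr fun m => congr_arg _ (R.toReal_signal_fadingPoint (hp _ hbl m) (hg _ hbl m))
  have hne := ENNReal.add_ne_top.1 (R.interferenceNoise_ne_top (n := n) hb hfin)
  have hne' := ENNReal.add_ne_top.1 hne.2
  rw [Network.interferenceNoise, ENNReal.toReal_add hne.1 hne.2, hown, Network.externalNoise,
    ENNReal.toReal_add hne'.1 hne'.2, ENNReal.toReal_sum (ENNReal.sum_ne_top.1 hne'.1),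
    Finset.sum_congr rfl hother, Finset.sum_insertNone, ENNReal.toReal_ofReal (sq_nonneg _),
    Network.interference, hn, add_assoc, add_assoc, add_assoc]
  rfl

end Sinr

lemma indepFun_sum_of_notMem {Ω ι E : Type*} [MeasurableSpace Ω] [MeasurableSpace E]
    {P : Measure Ω} {Y : ι → Ω → E} (hY : ∀ i, Measurable (Y i)) (hind : iIndepFun Y P)
    {f : E → ℝ≥0∞} (hf : Measurable f) {s : Finset ι} {j : ι} (hj : j ∉ s) :
    IndepFun (fun ω => ∑ i ∈ s, f (Y i ω)) (Y j) P := by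
  have h := hind.indepFun_finset s {j} (Finset.disjoint_singleton_right.2 hj) hY
  have hφ : Measurable fun y : s → E => ∑ i, f (y i) := by fun_prop
  have hsum : (fun ω => ∑ i ∈ s, f (Y i ω)) = (fun y : s → E => ∑ i, f (y i)) ∘
      fun ω i => Y i ω := funext fun ω => (Finset.sum_coe_sort s fun i => f (Y i ω)).symm
  rw [hsum]
  exact h.comp hφ (measurable_pi_apply ⟨j, Finset.mem_singleton_self j⟩)

section Coverage

variable {S B Ω : Type*} {N : Params S B} [MeasurableSpace Ω] {P : Measure Ω}
  {R : Network N Ω} {l : N.Band} {o : Option B} {b : B}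

lemma Network.IsModel.ae_gain_pos (hR : R.IsModel P) (ho : o ∈ (N.lessees l).insertNone) :
    ∀ᵐ ω ∂P, ∀ n, 0 < R.gain l o n ω :=
  ae_all_iff.2 fun n =>
    ((hR.hasLaw_gain ho n).ae_iff measurableSet_Ioi.mem).2 ae_pos_expMeasure_one

lemma Network.IsModel.measurable_totalSignal (hR : R.IsModel P) (l : N.Band) (o : Option B) :
    Measurable (R.totalSignal l o) :=
  .tsum fun n => (measurable_signal N.α).comp (hR.measurable_fadingPoint l o n)

lemma Network.IsModel.measurable_externalNoise [DecidableEq B] (hR : R.IsModel P) (l : N.Band)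
    (b : B) :
    Measurable (R.externalNoise l b) :=
  (Finset.measurable_fun_sum _ fun o _ => hR.measurable_totalSignal l o).add_const _

lemma Network.IsModel.measurable_interferenceNoise [DecidableEq B] (hR : R.IsModel P)
    (l : N.Band) (b : B) (n : ℕ) : Measurable (R.interferenceNoise l b n) := by
  have hfading := hR.measurable_fadingPoint l (some b)
  have hext := hR.measurable_externalNoise l b
  unfold Network.interferenceNoise
  fun_prop

lemma Network.coverageIntegrand_eq [DecidableEq B] {β z : ℝ} (hβ : 0 ≤ β) (hz : 0 ≤ z) :
    R.coverageIntegrand P l b β z = R.pointIntensity P l (some b)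
      * (Real.exp (-(β * z ^ (N.α / 2) * N.σ ^ 2
          + (∑ o ∈ ((N.lessees l).erase b).insertNone, R.pointIntensity P l o)
            * ((β * z ^ (N.α / 2)) ^ (2 / N.α) * rhoInf N.α)))
        * Real.exp (-(R.pointIntensity P l (some b) * z * (1 + β ^ (2 / N.α) * rho N.α β)))) := by
  have hα := N.α_gt
  rw [Network.coverageIntegrand, Network.laplaceI, mul_rpow_rpow_div_two (by positivity) hβ hz,
    mul_assoc, mul_assoc]
  simp only [← Real.exp_add, Finset.sum_insertNone, Network.pointIntensity, otherIntensity,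
    Finset.mul_sum, Finset.sum_mul]
  congr 2
  simp only [← Finset.sum_mul, ← Finset.mul_sum]
  ring

variable [IsProbabilityMeasure P]

lemma Network.IsModel.pointIntensity_pos (hR : R.IsModel P) (l : N.Band) (o : Option B) :
    0 < R.pointIntensity P l o := by
  cases o with
  | none =>
    exact mul_pos (mul_pos Real.pi_pos (N.lamS_pos l.1)) (Real.rpow_pos_of_pos N.PS_pos _)
  | some k => exact mul_pos (mul_pos Real.pi_pos (N.lamB_pos k)) (hR.powMoment_pos l)

lemma Network.IsModel.ae_power_pos (hR : R.IsModel P) (ho : o ∈ (N.lessees l).insertNone) :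
    ∀ᵐ ω ∂P, ∀ n, 0 < R.power l o n ω := by
  cases o with
  | none => exact ae_of_all _ fun _ _ => N.PS_pos
  | some k =>
    have hk := Finset.some_mem_insertNone.1 ho
    exact ae_all_iff.2 fun n => (hR.powB_law l k hk n).symm.ae_snd measurableSet_Ioi
      ((hR.ae_refPow l).mono fun ω hω => hω.1)

lemma Network.IsModel.ae_regular (hR : R.IsModel P) (l : N.Band) :
    ∀ᵐ ω ∂P, ∀ o ∈ (N.lessees l).insertNone, R.totalSignal l o ω ≠ ∞ ∧
      ∀ n, 0 < R.power l o n ω ∧ 0 < R.gain l o n ω ∧ 0 < R.point l o n ω := by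
  refine (Finset.eventually_all _).2 fun o ho => ?_
  filter_upwards [(hR.isPPP_fadingPoint ho).ae_tsum_signal_ne_top N.α_gt
    (hR.pointIntensity_pos l o).le, hR.ae_power_pos ho, hR.ae_gain_pos ho,
    (hR.isPPP_point ho).ae_pos] with ω htotal hpower hgain hpoint
  exact ⟨htotal, fun n => ⟨hpower n, hgain n, hpoint n⟩⟩

lemma Network.IsModel.ae_existsUnique_nearest (hR : R.IsModel P) (hb : b ∈ N.lessees l) :
    ∀ᵐ ω ∂P, ∃! n, ∀ m, R.point l (some b) n ω ≤ R.point l (some b) m ω :=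
  (hR.isPPP_point (Finset.some_mem_insertNone.2 hb)).ae_existsUnique_nearest
    (hR.pointIntensity_pos l _)

variable [DecidableEq B]

lemma Network.IsModel.ae_sinr_eq (hR : R.IsModel P) (hb : b ∈ N.lessees l) :
    ∀ᵐ ω ∂P, ∀ n, (∀ m, R.point l (some b) n ω ≤ R.point l (some b) m ω) →
      R.sinr l b ω = (signal N.α (R.fadingPoint l (some b) n ω)).toReal
        / (R.interferenceNoise l b n ω).toReal := by
  have hbl : some b ∈ (N.lessees l).insertNone := Finset.some_mem_insertNone.2 hb
  filter_upwards [hR.ae_regular l, hR.ae_existsUnique_nearest hb] with ω hreg huniq n hn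
  have hserving : R.serving l b ω = n :=
    R.serving_eq (fun m => ((hreg _ hbl).2 m).1.le) (fun m => ((hreg _ hbl).2 m).2.2) hn huniq
  rw [R.toReal_interferenceNoise hb (fun o ho => (hreg o ho).1)
    (fun o ho m => ((hreg o ho).2 m).1.le) (fun o ho m => ((hreg o ho).2 m).2.1.le) hserving,
    R.toReal_signal_fadingPoint ((hreg _ hbl).2 n).1.le ((hreg _ hbl).2 n).2.1.le,
    Network.sinr, hserving]
  rfl

lemma Network.IsModel.ae_lt_sinr_iff (hR : R.IsModel P) (hb : b ∈ N.lessees l) {β : ℝ}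
    (hβ : 0 < β) :
    ∀ᵐ ω ∂P, β < R.sinr l b ω ↔
      ∃ n, (fun m => R.fadingPoint l (some b) m ω, R.externalNoise l b ω)
        ∈ nearestCovered N.α β n := by
  filter_upwards [hR.ae_regular l, hR.ae_sinr_eq hb, hR.ae_existsUnique_nearest hb]
    with ω hreg hsinr ⟨n, hn, huniq⟩
  have hseller := (hreg none Finset.none_mem_insertNone).2 0
  have hne_top := R.interferenceNoise_ne_top (n := n) hb fun o ho => (hreg o ho).1
  have hne_zero := R.interferenceNoise_ne_zero (b := b) (n := n) hseller.2.1 hseller.2.2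
  have hlt : β < R.sinr l b ω ↔ ENNReal.ofReal β * R.interferenceNoise l b n ω
      < signal N.α (R.fadingPoint l (some b) n ω) := by
    rw [hsinr n hn, lt_div_iff₀ (ENNReal.toReal_pos hne_zero hne_top),
      ← ENNReal.toReal_lt_toReal (ENNReal.mul_ne_top ENNReal.ofReal_ne_top hne_top)
        (signal_ne_top _ _), ENNReal.toReal_mul, ENNReal.toReal_ofReal hβ.le]
  rw [hlt]
  refine ⟨fun h => ⟨n, hn, h⟩, fun ⟨k, hk, h⟩ => ?_⟩
  exact huniq k hk ▸ h

lemma Network.IsModel.aemeasurable_sinr (hR : R.IsModel P) (hb : b ∈ N.lessees l) :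
    AEMeasurable (R.sinr l b) P := by
  set nearest : ℕ → Set Ω := fun n => {ω | ∀ m, R.point l (some b) n ω ≤ R.point l (some b) m ω}
  have hfading := hR.measurable_fadingPoint l (some b)
  have hmeas : ∀ n, MeasurableSet (nearest n) := fun n =>
    measurableSet_forall_le (hfading n).fst fun m => (hfading m).fst
  have huniv : ⋃ n, nearest n =ᵐ[P] univ :=
    eventuallyEq_univ.2 ((hR.ae_existsUnique_nearest hb).mono fun ω hω =>
      mem_iUnion.2 hω.exists)
  rw [← Measure.restrict_univ (μ := P), ← Measure.restrict_congr_set huniv,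
    aemeasurable_iUnion_iff]
  refine fun n => ⟨fun ω => (signal N.α (R.fadingPoint l (some b) n ω)).toReal
    / (R.interferenceNoise l b n ω).toReal, ?_, ?_⟩
  · exact ((measurable_signal N.α).comp (hfading n)).ennreal_toReal.div
      (hR.measurable_interferenceNoise l b n).ennreal_toReal
  · exact (ae_restrict_iff' (hmeas n)).2 ((hR.ae_sinr_eq hb).mono fun ω hω => hω n)

lemma Network.IsModel.measure_lt_sinr_eq_tsum (hR : R.IsModel P) (hb : b ∈ N.lessees l) {β : ℝ}
    (hβ : 0 < β) :
    P {ω | β < R.sinr l b ω}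
      = ∑' n, P {ω | (fun m => R.fadingPoint l (some b) m ω, R.externalNoise l b ω)
        ∈ nearestCovered N.α β n} := by
  have hfield : Measurable fun ω => (fun m => R.fadingPoint l (some b) m ω,
      R.externalNoise l b ω) :=
    (measurable_pi_lambda _ (hR.measurable_fadingPoint l (some b))).prodMk
      (hR.measurable_externalNoise l b)
  refine Eq.trans ?_ (measure_iUnion₀ (fun i j hij => ?_)
    fun n => (hfield (measurableSet_nearestCovered n)).nullMeasurableSet)
  · exact measure_congr (eventuallyEq_set.2 ((hR.ae_lt_sinr_iff hb hβ).mono fun ω hω =>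
      hω.trans (by simp only [mem_iUnion, mem_ofPred_eq])))
  · refine measure_eq_zero_iff_ae_notMem.2 ((hR.ae_existsUnique_nearest hb).mono ?_)
    exact fun ω hω h => hij (hω.unique h.1.1 h.2.1)

lemma Network.IsModel.lintegral_negExp_externalNoise (hR : R.IsModel P) {κ : ℝ}
    (hκ : 0 < κ) :
    ∫⁻ ω, negExp (ENNReal.ofReal κ * R.externalNoise l b ω) ∂P
      = negExp (ENNReal.ofReal (κ * N.σ ^ 2
        + (∑ o ∈ ((N.lessees l).erase b).insertNone, R.pointIntensity P l o)
          * (κ ^ (2 / N.α) * rhoInf N.α))) := by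
  have hmeas : ∀ o, Measurable fun ω => ENNReal.ofReal κ * R.totalSignal l o ω := fun o =>
    (hR.measurable_totalSignal l o).const_mul _
  have hindep : iIndepFun (fun o ω => ENNReal.ofReal κ * R.totalSignal l o ω) P :=
    (hR.iIndepFun_fadingPoint l).comp
      (fun _ Y => ENNReal.ofReal κ * ∑' n, signal N.α (Y n)) fun _ => by fun_prop
  have hop : ∀ o ∈ ((N.lessees l).erase b).insertNone,
      ∫⁻ ω, negExp (ENNReal.ofReal κ * R.totalSignal l o ω) ∂P
        = negExp (ENNReal.ofReal (R.pointIntensity P l o * (κ ^ (2 / N.α) * rhoInf N.α))) :=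
    fun o ho => (hR.isPPP_fadingPoint
      (insertNone_erase_subset ho)).lintegral_negExp_mul_tsum_signal N.α_gt
        (hR.pointIntensity_pos l o).le hκ
  have hnonneg : ∀ o, 0 ≤ R.pointIntensity P l o * (κ ^ (2 / N.α) * rhoInf N.α) := fun o =>
    mul_nonneg (hR.pointIntensity_pos l o).le
      (mul_nonneg (Real.rpow_nonneg hκ.le _) (rhoInf_pos N.α_gt).le)
  simp_rw [Network.externalNoise, mul_add, Finset.mul_sum, negExp_add]
  rw [lintegral_mul_const _ (by fun_prop), lintegral_negExp_sum_of_iIndepFun hmeas hindep,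
    Finset.prod_congr rfl hop, ← negExp_sum, ← ENNReal.ofReal_sum_of_nonneg fun o _ => hnonneg o,
    ← ENNReal.ofReal_mul hκ.le, ← negExp_add,
    ← ENNReal.ofReal_add (Finset.sum_nonneg fun o _ => hnonneg o) (by positivity),
    Finset.sum_mul, add_comm]

lemma Network.IsModel.indepFun_externalNoise (hR : R.IsModel P) (l : N.Band) (b : B) :
    IndepFun (R.externalNoise l b) (fun ω n => R.fadingPoint l (some b) n ω) P := by
  have hmeas : ∀ o, Measurable fun ω n => R.fadingPoint l o n ω := fun o =>
    measurable_pi_lambda _ (hR.measurable_fadingPoint l o)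
  exact (indepFun_sum_of_notMem hmeas (hR.iIndepFun_fadingPoint l)
    (f := fun Y => ∑' n, signal N.α (Y n)) (by fun_prop) (by simp)).comp
    (measurable_id.add_const (ENNReal.ofReal (N.σ ^ 2))) measurable_id

lemma Network.IsModel.measure_lt_sinr (hR : R.IsModel P) (hb : b ∈ N.lessees l) {β : ℝ}
    (hβ : 0 < β) :
    P {ω | β < R.sinr l b ω}
      = ∫⁻ z in Ioi 0, ENNReal.ofReal (R.coverageIntegrand P l b β z) := by
  have hown := hR.isPPP_fadingPoint (Finset.some_mem_insertNone.2 hb)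
  have hc := hR.pointIntensity_pos l (some b)
  have hother := Finset.sum_nonneg (s := ((N.lessees l).erase b).insertNone)
    fun o _ => (hR.pointIntensity_pos l o).le
  rw [hR.measure_lt_sinr_eq_tsum hb hβ,
    hown.tsum_measure_nearestCovered_of_indepFun (hR.measurable_externalNoise l b)
      (hR.indepFun_externalNoise l b) N.α_gt hc.le hβ, lintegral_halfLineIntensity,
    ← lintegral_const_mul' _ _ ENNReal.ofReal_ne_top]
  refine setLIntegral_congr_fun measurableSet_Ioi fun z (hz : 0 < z) => ?_
  have hκ : 0 < β * z ^ (N.α / 2) := by positivity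
  have hρ := rho_nonneg (α := N.α) hβ.le
  have hρInf := rhoInf_pos N.α_gt
  change ENNReal.ofReal _ * _ = _
  rw [hR.lintegral_negExp_externalNoise hκ, negExp_ofReal (by positivity),
    negExp_ofReal (by positivity), ← ENNReal.ofReal_mul (by positivity),
    ← ENNReal.ofReal_mul (by positivity), Network.coverageIntegrand_eq hβ.le hz.le]

end Coverage

section ConditionalLaw

variable {Ω E F : Type*} [MeasurableSpace Ω] [MeasurableSpace E] [MeasurableSpace F]
  [StandardBorelSpace F] [Nonempty F] {P : Measure Ω} [IsFiniteMeasure P] {X : Ω → E} {Y : Ω → F}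

lemma integral_condDistrib_comp {G : Type*} [NormedAddCommGroup G] [NormedSpace ℝ G] {f : F → G}
    (hX : AEMeasurable X P) (hY : AEMeasurable Y P) (hf : StronglyMeasurable f)
    (hint : Integrable (fun ω => f (Y ω)) P) :
    ∫ p, (∫ y, f y ∂(condDistrib Y X P p)) ∂(P.map X) = ∫ ω, f (Y ω) ∂P := by
  have hm : StronglyMeasurable fun q : E × F => f q.2 := hf.comp_measurable measurable_snd
  have hi : Integrable (fun q : E × F => f q.2) (P.map X ⊗ₘ condDistrib Y X P) := by
    rw [compProd_map_condDistrib hY, integrable_map_measure hm.aestronglyMeasurable (hX.prodMk hY)]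
    exact hint
  rw [← Measure.integral_compProd hi, compProd_map_condDistrib hY,
    integral_map (hX.prodMk hY) hm.aestronglyMeasurable]

lemma integral_condDistrib_eq_integral_meas_lt {f : F → ℝ} (hX : AEMeasurable X P)
    (hY : AEMeasurable Y P) (hf : Measurable f) (hint : Integrable (fun ω => f (Y ω)) P)
    (hnonneg : ∀ᵐ ω ∂P, 0 ≤ f (Y ω)) :
    ∫ p, (∫ y, f y ∂(condDistrib Y X P p)) ∂(P.map X)
      = ∫ p, (∫ t in Ioi (0 : ℝ), (condDistrib Y X P p).real {y | t < f y}) ∂(P.map X) := by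
  have hm : Measurable fun q : E × F => f q.2 := hf.comp measurable_snd
  have hi : Integrable (fun q : E × F => f q.2) (P.map fun ω => (X ω, Y ω)) := by
    rw [integrable_map_measure hm.aestronglyMeasurable (hX.prodMk hY)]
    exact hint
  have hnonneg' : ∀ᵐ q ∂(P.map X ⊗ₘ condDistrib Y X P), 0 ≤ f q.2 := by
    rw [compProd_map_condDistrib hY,
      ae_map_iff (hX.prodMk hY) (measurableSet_le measurable_const hm)]
    exact hnonneg
  refine integral_congr_ae ?_
  filter_upwards [hi.condDistrib_ae_map hY, Measure.ae_ae_of_ae_compProd hnonneg'] with p hp hp'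
  exact Integrable.integral_eq_integral_meas_lt hp hp'

end ConditionalLaw

section Rate

lemma measurable_rho (α : ℝ) : Measurable (rho α) := by
  have hs : MeasurableSet {q : ℝ × ℝ | q.1 ^ (-2 / α) < q.2} :=
    measurableSet_lt (by fun_prop) (by fun_prop)
  have hf : Measurable fun q : ℝ × ℝ => 1 / (1 + q.2 ^ (α / 2)) := by fun_prop
  have h : rho α = fun β => ∫ ν : ℝ, {q : ℝ × ℝ | q.1 ^ (-2 / α) < q.2}.indicator
      (fun q => 1 / (1 + q.2 ^ (α / 2))) (β, ν) := by
    funext β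
    rw [rho, ← integral_indicator measurableSet_Ioi]
    rfl
  rw [h]
  exact (hf.indicator hs).stronglyMeasurable.integral_prod_right'.measurable

lemma div_add_mul_rpow_exp_sub_one_le {p c D t : ℝ} (hp : 0 ≤ p) (hp1 : p ≤ 1) (hc : 0 < c)
    (hD : 0 < D) (ht : 0 ≤ t) :
    c / (c + D * (Real.exp t - 1) ^ p) ≤ c / min c D * Real.exp (-(p * t)) := by
  have hβ : 0 ≤ Real.exp t - 1 := sub_nonneg.2 (Real.one_le_exp ht)
  have hsub : Real.exp (p * t) ≤ 1 + (Real.exp t - 1) ^ p := by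
    simpa [← Real.exp_mul, mul_comm] using Real.rpow_add_le_add_rpow zero_le_one hβ hp hp1
  have hmin : min c D * Real.exp (p * t) ≤ c + D * (Real.exp t - 1) ^ p :=
    calc min c D * Real.exp (p * t) ≤ min c D * (1 + (Real.exp t - 1) ^ p) := by gcongr
      _ = min c D + min c D * (Real.exp t - 1) ^ p := by ring
      _ ≤ c + D * (Real.exp t - 1) ^ p := by
        gcongr
        · exact min_le_left _ _
        · exact min_le_right _ _
  rw [Real.exp_neg, ← div_eq_mul_inv, div_div]
  gcongr

variable {S B Ω : Type*} {N : Params S B} [MeasurableSpace Ω] {P : Measure Ω}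
  {R : Network N Ω} {l : N.Band} {b : B}

lemma Network.IsModel.measurable_powers (hR : R.IsModel P) (l : N.Band) :
    Measurable (R.powers l) :=
  measurable_pi_lambda _ fun k => measurable_pi_lambda _ fun n => hR.powB_meas l k n

variable [DecidableEq B]

lemma Network.measurable_coverageIntegrand (R : Network N Ω) (P : Measure Ω) (l : N.Band) (b : B) :
    Measurable fun q : ℝ × ℝ => R.coverageIntegrand P l b (Real.exp q.1 - 1) q.2 := by
  have hrho : Measurable fun q : ℝ × ℝ => rho N.α (Real.exp q.1 - 1) :=
    (measurable_rho N.α).comp (by fun_prop)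
  unfold Network.coverageIntegrand Network.laplaceI
  fun_prop

lemma Network.lintegral_prod_coverageIntegrand (R : Network N Ω) (P : Measure Ω) (l : N.Band)
    (b : B) :
    ∫⁻ q in Ioi (0 : ℝ) ×ˢ Ioi (0 : ℝ),
        ENNReal.ofReal (R.coverageIntegrand P l b (Real.exp q.1 - 1) q.2)
      = ∫⁻ t in Ioi 0, ∫⁻ z in Ioi 0,
        ENNReal.ofReal (R.coverageIntegrand P l b (Real.exp t - 1) z) := by
  rw [Measure.volume_eq_prod, ← Measure.prod_restrict, lintegral_prod]
  exact (R.measurable_coverageIntegrand P l b).ennreal_ofReal.aemeasurable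

variable [IsProbabilityMeasure P]

lemma Network.IsModel.coverageIntegrand_nonneg (hR : R.IsModel P) (l : N.Band) (b : B)
    (β z : ℝ) : 0 ≤ R.coverageIntegrand P l b β z := by
  have hc : 0 ≤ Real.pi * N.lamB b * R.powMoment P l := (hR.pointIntensity_pos l (some b)).le
  unfold Network.coverageIntegrand Network.laplaceI
  positivity

lemma Network.IsModel.coverageIntegrand_le (hR : R.IsModel P) {β z : ℝ} (hβ : 0 ≤ β)
    (hz : 0 ≤ z) :
    R.coverageIntegrand P l b β z ≤ R.pointIntensity P l (some b) *
      Real.exp (-((R.pointIntensity P l (some b)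
        + R.pointIntensity P l none * rhoInf N.α * β ^ (2 / N.α)) * z)) := by
  have hα := N.α_gt
  have hc := hR.pointIntensity_pos l (some b)
  have hsum : R.pointIntensity P l none
      ≤ ∑ o ∈ ((N.lessees l).erase b).insertNone, R.pointIntensity P l o :=
    Finset.single_le_sum (fun o _ => (hR.pointIntensity_pos l o).le) Finset.none_mem_insertNone
  have hρInf := rhoInf_pos hα
  have hexternal := mul_le_mul_of_nonneg_right hsum
    (show 0 ≤ β ^ (2 / N.α) * z * rhoInf N.α by positivity)
  have hnoise : 0 ≤ β * z ^ (N.α / 2) * N.σ ^ 2 := by positivity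
  have hown : 0 ≤ R.pointIntensity P l (some b) * z * (β ^ (2 / N.α) * rho N.α β) :=
    mul_nonneg (by positivity) (mul_nonneg (by positivity) (rho_nonneg hβ))
  rw [Network.coverageIntegrand_eq hβ hz, mul_rpow_rpow_div_two (by positivity) hβ hz,
    ← Real.exp_add]
  gcongr
  linarith

lemma Network.IsModel.lintegral_coverageIntegrand_le (hR : R.IsModel P) (l : N.Band) (b : B)
    {t : ℝ} (ht : 0 ≤ t) :
    ∫⁻ z in Ioi 0, ENNReal.ofReal (R.coverageIntegrand P l b (Real.exp t - 1) z)
      ≤ ENNReal.ofReal (R.pointIntensity P l (some b) /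
        min (R.pointIntensity P l (some b)) (R.pointIntensity P l none * rhoInf N.α))
        * ENNReal.ofReal (Real.exp (-(2 / N.α * t))) := by
  have hα := N.α_gt
  have hβ : 0 ≤ Real.exp t - 1 := sub_nonneg.2 (Real.one_le_exp ht)
  have hc := hR.pointIntensity_pos l (some b)
  have hD : 0 < R.pointIntensity P l none * rhoInf N.α :=
    mul_pos (hR.pointIntensity_pos l none) (rhoInf_pos hα)
  set c := R.pointIntensity P l (some b)
  set D := R.pointIntensity P l none * rhoInf N.α
  calc ∫⁻ z in Ioi 0, ENNReal.ofReal (R.coverageIntegrand P l b (Real.exp t - 1) z)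
      ≤ ∫⁻ z in Ioi 0, ENNReal.ofReal c *
          ENNReal.ofReal (Real.exp (-((c + D * (Real.exp t - 1) ^ (2 / N.α)) * z))) := by
        refine setLIntegral_mono' measurableSet_Ioi fun z hz => ?_
        rw [← ENNReal.ofReal_mul hc.le]
        exact ENNReal.ofReal_le_ofReal (hR.coverageIntegrand_le hβ (le_of_lt hz))
    _ = ENNReal.ofReal (c / (c + D * (Real.exp t - 1) ^ (2 / N.α))) := by
        rw [lintegral_const_mul _ (by fun_prop), lintegral_Ioi_exp_neg_mul (by positivity),
          ← ENNReal.ofReal_mul hc.le]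
        simp [div_eq_mul_inv]
    _ ≤ ENNReal.ofReal (c / min c D) * ENNReal.ofReal (Real.exp (-(2 / N.α * t))) := by
        rw [← ENNReal.ofReal_mul (by positivity)]
        refine ENNReal.ofReal_le_ofReal
          (div_add_mul_rpow_exp_sub_one_le (by positivity) ?_ hc hD ht)
        exact div_le_one_of_le₀ hα.le (by positivity)

lemma Network.IsModel.lintegral_lintegral_coverageIntegrand_ne_top (hR : R.IsModel P)
    (l : N.Band) (b : B) :
    ∫⁻ t in Ioi 0, ∫⁻ z in Ioi 0, ENNReal.ofReal (R.coverageIntegrand P l b (Real.exp t - 1) z)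
      ≠ ∞ := by
  have hα := N.α_gt
  refine ne_top_of_le_ne_top ?_ (setLIntegral_mono' measurableSet_Ioi fun t ht =>
    hR.lintegral_coverageIntegrand_le l b (le_of_lt ht))
  rw [lintegral_const_mul _ (by fun_prop), lintegral_Ioi_exp_neg_mul (by positivity)]
  exact ENNReal.mul_ne_top ENNReal.ofReal_ne_top ENNReal.ofReal_ne_top

lemma Network.IsModel.integrableOn_coverageIntegrand (hR : R.IsModel P) (l : N.Band) (b : B) :
    IntegrableOn (fun q : ℝ × ℝ => R.coverageIntegrand P l b (Real.exp q.1 - 1) q.2)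
      (Ioi 0 ×ˢ Ioi 0) := by
  refine (lintegral_ofReal_ne_top_iff_integrable
    (R.measurable_coverageIntegrand P l b).aestronglyMeasurable
    (ae_of_all _ fun q => hR.coverageIntegrand_nonneg l b _ _)).1 ?_
  rw [R.lintegral_prod_coverageIntegrand]
  exact hR.lintegral_lintegral_coverageIntegrand_ne_top l b

lemma Network.IsModel.toReal_lintegral_coverageIntegrand (hR : R.IsModel P) (l : N.Band)
    (b : B) :
    (∫⁻ t in Ioi 0, ∫⁻ z in Ioi 0,
        ENNReal.ofReal (R.coverageIntegrand P l b (Real.exp t - 1) z)).toReal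
      = ∫ t in Ioi (0 : ℝ), ∫ z in Ioi (0 : ℝ), R.coverageIntegrand P l b (Real.exp t - 1) z := by
  have hint := hR.integrableOn_coverageIntegrand l b
  rw [← R.lintegral_prod_coverageIntegrand, ← integral_eq_lintegral_of_nonneg_ae
    (ae_of_all _ fun q => hR.coverageIntegrand_nonneg l b _ _)
    (R.measurable_coverageIntegrand P l b).aestronglyMeasurable]
  rw [Measure.volume_eq_prod] at hint ⊢
  exact setIntegral_prod _ hint

lemma Network.IsModel.ae_sinr_nonneg (hR : R.IsModel P) (hb : b ∈ N.lessees l) :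
    ∀ᵐ ω ∂P, 0 ≤ R.sinr l b ω := by
  filter_upwards [hR.ae_sinr_eq hb, hR.ae_existsUnique_nearest hb] with ω hsinr ⟨n, hn, _⟩
  rw [hsinr n hn]
  positivity

lemma Network.IsModel.ae_log_sinr_nonneg (hR : R.IsModel P) (hb : b ∈ N.lessees l) :
    ∀ᵐ ω ∂P, 0 ≤ Real.log (1 + R.sinr l b ω) :=
  (hR.ae_sinr_nonneg hb).mono fun _ h => Real.log_nonneg (le_add_of_nonneg_right h)

lemma Network.IsModel.aemeasurable_log_sinr (hR : R.IsModel P) (hb : b ∈ N.lessees l) :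
    AEMeasurable (fun ω => Real.log (1 + R.sinr l b ω)) P :=
  Real.measurable_log.comp_aemeasurable ((hR.aemeasurable_sinr hb).const_add 1)

lemma Network.IsModel.lintegral_log_sinr (hR : R.IsModel P) (hb : b ∈ N.lessees l) :
    ∫⁻ ω, ENNReal.ofReal (Real.log (1 + R.sinr l b ω)) ∂P
      = ∫⁻ t in Ioi 0, ∫⁻ z in Ioi 0,
        ENNReal.ofReal (R.coverageIntegrand P l b (Real.exp t - 1) z) := by
  rw [lintegral_eq_lintegral_meas_lt P (hR.ae_log_sinr_nonneg hb) (hR.aemeasurable_log_sinr hb)]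
  refine setLIntegral_congr_fun measurableSet_Ioi fun t (ht : 0 < t) => ?_
  change P {ω | t < Real.log (1 + R.sinr l b ω)} = _
  rw [← hR.measure_lt_sinr hb (sub_pos.2 (Real.one_lt_exp_iff.2 ht))]
  refine measure_congr (eventuallyEq_set.2 ((hR.ae_sinr_nonneg hb).mono fun ω hω => ?_))
  simp only [mem_ofPred_eq]
  rw [Real.lt_log_iff_exp_lt (by positivity), sub_lt_iff_lt_add']

lemma Network.IsModel.integrable_log_sinr (hR : R.IsModel P) (hb : b ∈ N.lessees l) :
    Integrable (fun ω => Real.log (1 + R.sinr l b ω)) P := by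
  refine (lintegral_ofReal_ne_top_iff_integrable (hR.aemeasurable_log_sinr hb).aestronglyMeasurable
    (hR.ae_log_sinr_nonneg hb)).1 ?_
  rw [hR.lintegral_log_sinr hb]
  exact hR.lintegral_lintegral_coverageIntegrand_ne_top l b

lemma Network.IsModel.integral_log_sinr (hR : R.IsModel P) (hb : b ∈ N.lessees l) :
    ∫ ω, Real.log (1 + R.sinr l b ω) ∂P
      = ∫ t in Ioi (0 : ℝ), ∫ z in Ioi (0 : ℝ), R.coverageIntegrand P l b (Real.exp t - 1) z := by
  rw [integral_eq_lintegral_of_nonneg_ae (hR.ae_log_sinr_nonneg hb)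
    (hR.aemeasurable_log_sinr hb).aestronglyMeasurable, hR.lintegral_log_sinr hb,
    hR.toReal_lintegral_coverageIntegrand]

end Rate

end SpectrumSharing

theorem theorem3 {S B Ω : Type*} [Fintype S] [DecidableEq B] [MeasurableSpace Ω]
    (P : MeasureTheory.Measure Ω) [MeasureTheory.IsProbabilityMeasure P]
    (N : SpectrumSharing.Params S B) (R : SpectrumSharing.Network N Ω) (hR : R.IsModel P) (b : B) :
    (∀ l : N.Band, b ∈ N.lessees l →
      AEMeasurable (R.sinr l b) P ∧
      MeasureTheory.Integrable (fun ω => Real.log (1 + R.sinr l b ω)) P ∧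
      MeasureTheory.Integrable (fun ω => R.refPow l ω ^ (2 / N.α)) P ∧
      MeasureTheory.IntegrableOn
        (fun q : ℝ × ℝ => R.coverageIntegrand P l b (Real.exp q.1 - 1) q.2)
        (Set.Ioi 0 ×ˢ Set.Ioi 0)) ∧
    R.averageRate P b =
      ∑ l : N.Band with b ∈ N.lessees l,
        ∫ p, (∫ t in Set.Ioi (0 : ℝ), (R.sinrLaw P l b p).real {γ | t < Real.log (1 + γ)})
          ∂(R.powerLaw P l) ∧
    R.averageRate P b =
      ∑ l : N.Band with b ∈ N.lessees l,
        ∫ t in Set.Ioi (0 : ℝ), ∫ z in Set.Ioi (0 : ℝ),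
          R.coverageIntegrand P l b (Real.exp t - 1) z := by
  have hlog : Measurable fun γ : ℝ => Real.log (1 + γ) := by fun_prop
  refine ⟨fun l hb => ⟨hR.aemeasurable_sinr hb, hR.integrable_log_sinr hb,
    hR.integrable_refPow_rpow l, hR.integrableOn_coverageIntegrand l b⟩, ?_, ?_⟩
  · refine Finset.sum_congr rfl fun l hl => ?_
    have hb := (Finset.mem_filter.1 hl).2
    exact SpectrumSharing.integral_condDistrib_eq_integral_meas_lt
      (hR.measurable_powers l).aemeasurable (hR.aemeasurable_sinr hb) hlog
      (hR.integrable_log_sinr hb) (hR.ae_log_sinr_nonneg hb)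
  · refine Finset.sum_congr rfl fun l hl => ?_
    have hb := (Finset.mem_filter.1 hl).2
    exact (SpectrumSharing.integral_condDistrib_comp (hR.measurable_powers l).aemeasurable
      (hR.aemeasurable_sinr hb) hlog.stronglyMeasurable (hR.integrable_log_sinr hb)).trans
      (hR.integral_log_sinr hb)
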